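/- **Setting.** Let $E\subset\mathbb{R}^d$ be open and let $(\Phi,\lambda,Q)$ be the local characteristics of a piecewise-deterministic Markov process: $\Phi:\mathbb{R}^d\times\mathbb{R}^+\to\mathbb{R}^d$ is a continuous flow ($\Phi(\cdot,t)$ is a homeomorphism for every $t$ and $\Phi(x,t+s)=\Phi(\Phi(x,s),t)$), $\lambda:\overline E\to\mathbb{R}^+$ is a bounded measurable jump rate, and $Q$ is a Markov kernel on $\overline E$ with $Q(x,E\setminus\{x\})=1$ for all $x\in\overline E$. Put $t^*(x)=\inf\{t>0:\Phi(x,t)\in\partial E\}$ (with $\inf\emptyset=+\infty$) and $\Lambda(x,t)=\int_0^t\lambda(\Phi(x,s))\,ds$. Assume that there is a finite set $E_0=\{x_1,\dots,x_q\}\subset E$ of distinct points with $Q(x,E_0)=1$ for all $x\in\overline E$ and $0<t^*_i:=t^*(x_i)<\infty$ for all $i$. Let $\mathcal{M}_1(E_0)$ be the set of probability measures on $E_0$, with $\pi^i=\pi(\{x_i\})$, and let $g:\overline E\to\mathbb{R}$ be bounded and measurable. Let $\pi\in\mathcal{M}_1(E_0)$, and let $(Z_n,S_n)_{n\ge0}$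 be post-jump locations and inter-jump times of the process with initial law $\pi$: $Z_0\sim\pi$, $S_0=0$ and, for all $n\ge 0$, conditionally on $(Z_0,S_0,\dots,Z_n,S_n)$, the variable $S_{n+1}$ has survival function $t\mapsto \mathbf 1_{\{t<t^*(Z_n)\}}e^{-\Lambda(Z_n,t)}$ on $\mathbb{R}^+$; conditionally on $(Z_0,S_0,\dots,Z_n,S_n,S_{n+1})$, the variable $Z_{n+1}$ has law $Q(\Phi(Z_n,S_{n+1}),\cdot)$. Put $T_n=S_1+\dots+S_n$ and $X_t=\Phi(Z_n,t-T_n)$ for $T_n\le t<T_{n+1}$. The observations are $Y_0=y_0\in\mathbb{R}^d$, deterministic, and $Y_n=\varphi(Z_n)+W_n$ for $n\ge1$, where $\varphi:E_0\to\mathbb{R}^d$ and $(W_n)_{n\ge1}$ are i.i.d. $\mathbb{R}^d$-valued variables with a bounded density, independent of $(Z_n,S_n)_{n\ge 0}$. Let $\mathfrak F^Y$ be the filtration generated by $Y_t=\sum_{j\ge0}\mathbf 1_{[T_j,T_{j+1}[}(t)\,Y_j$, $t\ge0$, completed with the null sets, and let $\Pi_n\in\mathcal{M}_1(E_0)$ be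 the filter, $\Pi_n^i=\mathbf P(Z_n=x_i\mid\mathfrak F^Y_{T_n})$. Since $Y_0$ is deterministic, $\Pi_0=\pi$ almost surely; $\mathbf E[\,\cdot\mid\Pi_0=\pi]$ denotes expectation under the probability measure conditioned on this event. **Proposition.** Let $\sigma$ be an almost surely finite $\mathfrak F^Y$-stopping time and $n\ge1$. Then $\mathbf P(\Pi_0=\pi)=1$. There is a sequence $(R_k)_{k\ge0}$ of nonnegative random variables such that, for every $k\geq 0$, $R_k$ is $\mathfrak F^Y_{T_k}$-measurable and, almost surely, $$\sigma\wedge T_{k+1}=(T_k+R_k)\wedge T_{k+1}\quad\text{on }\{\sigma\ge T_k\}.$$ For every such sequence one has $$\mathbf E[g(X_{\sigma\wedge T_n})\mid\Pi_0=\pi]=\sum_{k=0}^{n-1}\sum_{i=1}^q\mathbf E\big[\mathbf 1_{\{T_k\le\sigma\}}\mathbf 1_{\{R_k<t^*_i\}}\,g(\Phi(x_i,R_k))\,e^{-\Lambda(x_i,R_k)}\,\Pi_k^i\,\big|\,\Pi_0=\pi\big]+\sum_{i=1}^q\mathbf E\big[\mathbf 1_{\{T_n\le\sigma\}}\,g(x_i)\,\Pi_n^i\,\big|\,\Pi_0=\pi\big],$$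 all the random variables under these expectations being integrable. -/

import Mathlib

open MeasureTheory ProbabilityTheory Set
open scoped NNReal ENNReal

noncomputable section

/-- Local characteristics `(Φ, λ, Q)` of a piecewise-deterministic Markov process on an open set
`E` of `ℝ^d`. Functions that the theory only uses on the closure of `E` (the jump rate `λ` and the
kernel `Q`) are total functions; every requirement bears on the closure of `E` only (any Markov
kernel on the closure of `E` extends to a Markov kernel on the whole space). -/
structure PDMP (d : ℕ) where
  /-- the state space -/
  E : Set (EuclideanSpace ℝ (Fin d))
  isOpen_E : IsOpen E
  /-- the flow `Φ(x, t)` -/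
  flow : EuclideanSpace ℝ (Fin d) → ℝ≥0 → EuclideanSpace ℝ (Fin d)
  continuous_flow : Continuous (Function.uncurry flow)
  isHomeomorph_flow : ∀ t, IsHomeomorph (fun x => flow x t)
  flow_add : ∀ x s t, flow x (t + s) = flow (flow x s) t
  /-- the jump rate `λ` -/
  rate : EuclideanSpace ℝ (Fin d) → ℝ
  measurable_rate : Measurable ((closure E).domRestrict rate)
  rate_nonneg : ∀ x ∈ closure E, 0 ≤ rate x
  rate_locally_integrable : ∀ x ∈ E, ∃ ε : ℝ, 0 < ε ∧
    IntervalIntegrable (fun s : ℝ => rate (flow x s.toNNReal)) volume 0 ε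
  /-- the transition kernel `Q` selecting the post-jump location -/
  Q : Kernel (EuclideanSpace ℝ (Fin d)) (EuclideanSpace ℝ (Fin d))
  isMarkovKernel_Q : IsMarkovKernel Q
  Q_move : ∀ x ∈ closure E, Q x (E \ {x}) = 1

namespace PDMP

variable {d : ℕ} (M : PDMP d)

/-- The deterministic exit time `t^*(x) = inf {t > 0 : Φ(x, t) ∈ ∂E}`, with `inf ∅ = ∞`. -/
def exitTime (x : EuclideanSpace ℝ (Fin d)) : ℝ≥0∞ :=
  sInf ((fun t : ℝ≥0 => (t : ℝ≥0∞)) '' {t | 0 < t ∧ M.flow x t ∈ frontier M.E})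

/-- The cumulated jump rate `Λ(x, t) = ∫_0^t λ(Φ(x, s)) ds`. -/
def cumRate (x : EuclideanSpace ℝ (Fin d)) (t : ℝ≥0) : ℝ :=
  ∫ s in (0 : ℝ)..t, M.rate (M.flow x s.toNNReal)

open Classical in
/-- Survival function of the time to the next jump when the motion starts from `x`. -/
def survival (x : EuclideanSpace ℝ (Fin d)) (t : ℝ≥0) : ℝ :=
  if (t : ℝ≥0∞) < M.exitTime x then Real.exp (-M.cumRate x t) else 0

end PDMP

/-- A PDMP whose post-jump locations belong to a finite set `E₀ = {x_1, …, x_q} ⊆ E`,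
with bounded jump rate, together with the data of the noisy observation of the post-jump locations:
the function `φ`, the bounded density `f_W` of the noise and the deterministic value `y₀` of the
observation at time `0`. Only the values of `φ` on `E₀` matter. -/
structure ObservedPDMP (d q : ℕ) extends PDMP d where
  /-- the points `x_1, …, x_q` -/
  pt : Fin q → EuclideanSpace ℝ (Fin d)
  pt_injective : Function.Injective pt
  pt_mem : ∀ i, pt i ∈ E
  Q_range : ∀ x ∈ closure E, Q x (range pt) = 1
  exitTime_pos : ∀ i, 0 < toPDMP.exitTime (pt i)
  exitTime_lt_top : ∀ i, toPDMP.exitTime (pt i) < ⊤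
  rate_bounded : ∃ C, ∀ x ∈ closure E, rate x ≤ C
  /-- the observation function `φ` -/
  obs : EuclideanSpace ℝ (Fin d) → EuclideanSpace ℝ (Fin d)
  measurable_obs : Measurable obs
  /-- the noise density `f_W` -/
  noiseDensity : EuclideanSpace ℝ (Fin d) → ℝ
  measurable_noiseDensity : Measurable noiseDensity
  noiseDensity_nonneg : ∀ w, 0 ≤ noiseDensity w
  noiseDensity_bounded : ∃ C, ∀ w, noiseDensity w ≤ C
  /-- the initial observation -/
  y0 : EuclideanSpace ℝ (Fin d)

/-- The past `σ(Z_0, S_0, …, Z_n, S_n)` of the embedded chain. -/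
@[reducible] def chainPast {d : ℕ} {Ω : Type*} (Z : ℕ → Ω → EuclideanSpace ℝ (Fin d)) (S : ℕ → Ω → ℝ≥0)
    (n : ℕ) : MeasurableSpace Ω :=
  MeasurableSpace.comap (fun ω (k : Fin (n + 1)) => (Z k ω, S k ω)) inferInstance

/-- A realization, on the probability space `(Ω, μ)`, of the observed PDMP started from the law
`∑ i, π i • δ_{x_i}`: the post-jump locations `Z_n`, the inter-jump times `S_n` and the noise
`W_n`, `n ≥ 1` (the variable `W 0` plays no role). Given the past of the chain, `S_{n+1}` has the
survival function attached to `Z_n`; given in addition `S_{n+1}`, the location `Z_{n+1}` has law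
`Q(Φ(Z_n, S_{n+1}), ·)`. -/
structure ObservedPDMP.Realization {d q : ℕ} (M : ObservedPDMP d q) (π : Fin q → ℝ)
    {Ω : Type*} {mΩ : MeasurableSpace Ω} (μ : Measure Ω) where
  Z : ℕ → Ω → EuclideanSpace ℝ (Fin d)
  S : ℕ → Ω → ℝ≥0
  W : ℕ → Ω → EuclideanSpace ℝ (Fin d)
  measurable_Z : ∀ n, Measurable (Z n)
  measurable_S : ∀ n, Measurable (S n)
  measurable_W : ∀ n, Measurable (W n)
  law_Z_zero : ∀ i, μ.real {ω | Z 0 ω = M.pt i} = π i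
  S_zero : ∀ ω, S 0 ω = 0
  law_S : ∀ (n : ℕ) (t : ℝ≥0),
    μ[{ω | t < S (n + 1) ω}.indicator (fun _ => (1 : ℝ)) | chainPast Z S n]
      =ᵐ[μ] fun ω => M.survival (Z n ω) t
  law_Z : ∀ (n : ℕ) (A : Set (EuclideanSpace ℝ (Fin d))), MeasurableSet A →
    μ[{ω | Z (n + 1) ω ∈ A}.indicator (fun _ => (1 : ℝ)) |
        chainPast Z S n ⊔ MeasurableSpace.comap (S (n + 1)) inferInstance]
      =ᵐ[μ] fun ω => (M.Q (M.flow (Z n ω) (S (n + 1) ω))).real A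
  law_W : ∀ n, μ.map (W (n + 1))
    = volume.withDensity (fun w => ENNReal.ofReal (M.noiseDensity w))
  iIndepFun_W : iIndepFun (fun n => W (n + 1)) μ
  indepFun_W : IndepFun (fun ω (n : ℕ) => W (n + 1) ω) (fun ω (n : ℕ) => (Z n ω, S n ω)) μ

namespace ObservedPDMP.Realization

variable {d q : ℕ} {M : ObservedPDMP d q} {π : Fin q → ℝ} {Ω : Type*} {mΩ : MeasurableSpace Ω}
  {μ : Measure Ω} (P : M.Realization π μ)

/-- The jump times `T_n = S_1 + ⋯ + S_n`. -/
def T (n : ℕ) (ω : Ω) : ℝ≥0 := ∑ k ∈ Finset.range n, P.S (k + 1) ω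

/-- The PDMP: `X_t = Φ(Z_j, t - T_j)` for `T_j ≤ t < T_{j+1}`. -/
def X (t : ℝ≥0) (ω : Ω) : EuclideanSpace ℝ (Fin d) :=
  ∑' j, (Ico (P.T j ω) (P.T (j + 1) ω)).indicator (fun s => M.flow (P.Z j ω) (s - P.T j ω)) t

/-- The observations `Y_0 = y₀` and `Y_n = φ(Z_n) + W_n` for `n ≥ 1`. -/
def Yobs (n : ℕ) (ω : Ω) : EuclideanSpace ℝ (Fin d) :=
  if n = 0 then M.y0 else M.obs (P.Z n ω) + P.W n ω

/-- The continuous-time observation process `Y_t = ∑_j 1_{[T_j, T_{j+1})}(t) Y_j`. -/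
def Y (t : ℝ≥0) (ω : Ω) : EuclideanSpace ℝ (Fin d) :=
  ∑' j, (Ico (P.T j ω) (P.T (j + 1) ω)).indicator (fun _ => P.Yobs j ω) t

theorem measurable_T (n : ℕ) : Measurable (P.T n) := by
  unfold T
  exact Finset.measurable_sum _ fun k _ => P.measurable_S (k + 1)

theorem monotone_T (ω : Ω) : Monotone fun n => P.T n ω := by
  intro a b hab
  exact Finset.sum_le_sum_of_subset (Finset.range_mono hab)

theorem measurable_Yobs (n : ℕ) : Measurable (P.Yobs n) := by
  unfold Yobs
  split_ifs
  · exact measurable_const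
  · exact (M.measurable_obs.comp (P.measurable_Z n)).add (P.measurable_W n)

theorem measurable_Y (t : ℝ≥0) : Measurable (P.Y t) := by
  let f : ℕ → Ω → EuclideanSpace ℝ (Fin d) := fun j ω =>
    (Ico (P.T j ω) (P.T (j + 1) ω)).indicator (fun _ => P.Yobs j ω) t
  have hf : ∀ j, Measurable (f j) := by
    intro j
    have h1 : MeasurableSet {ω | P.T j ω ≤ t} :=
      measurableSet_le (P.measurable_T j) measurable_const
    have h2 : MeasurableSet {ω | t < P.T (j + 1) ω} :=
      measurableSet_lt measurable_const (P.measurable_T (j + 1))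
    have hs : MeasurableSet {ω | t ∈ Ico (P.T j ω) (P.T (j + 1) ω)} := h1.inter h2
    have : f j = {ω | t ∈ Ico (P.T j ω) (P.T (j + 1) ω)}.indicator (P.Yobs j) := by
      funext ω
      simp [f, Set.indicator]
    rw [this]
    exact (P.measurable_Yobs j).indicator hs
  have hsum : ∀ ω, Summable fun j => f j ω := by
    intro ω
    refine summable_of_hasFiniteSupport ?_
    refine Set.Subsingleton.finite ?_
    intro a ha b hb
    have key : ∀ j, f j ω ≠ 0 → P.T j ω ≤ t ∧ t < P.T (j + 1) ω := by
      intro j hj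
      by_contra h
      have h' : t ∉ Ico (P.T j ω) (P.T (j + 1) ω) := h
      exact hj (Set.indicator_of_notMem h' _)
    have ha' := key a ha
    have hb' := key b hb
    by_contra hne
    rcases lt_or_gt_of_ne hne with h | h
    · exact absurd (ha'.2.trans_le ((P.monotone_T ω h).trans hb'.1)) (lt_irrefl _)
    · exact absurd (hb'.2.trans_le ((P.monotone_T ω h).trans ha'.1)) (lt_irrefl _)
  refine measurable_of_tendsto_metrizable
    (f := fun n ω => ∑ j ∈ Finset.range n, f j ω) (fun n => ?_) ?_
  · exact Finset.measurable_sum _ fun j _ => hf j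
  · rw [tendsto_pi_nhds]
    intro ω
    exact (hsum ω).hasSum.tendsto_sum_nat

/-- The observed filtration: `F_t` is generated by `Y_s`, `s ≤ t`, and by the null sets. -/
def filtration : Filtration ℝ≥0 mΩ where
  seq t := (⨆ s, ⨆ _ : s ≤ t, MeasurableSpace.comap (P.Y s) inferInstance) ⊔
    MeasurableSpace.generateFrom {A | MeasurableSet A ∧ μ A = 0}
  mono' := by
    intro s t hst
    refine sup_le_sup ?_ le_rfl
    exact iSup₂_le fun r hr => le_iSup₂_of_le (f := fun r (_ : r ≤ t) =>
      MeasurableSpace.comap (P.Y r) inferInstance) r (hr.trans hst) le_rfl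
  le' := by
    intro t
    refine sup_le ?_ (MeasurableSpace.generateFrom_le fun _ hA => hA.1)
    exact iSup₂_le fun s _ => (P.measurable_Y s).comap_le

/-- The set of almost surely finite stopping times of the observed filtration. -/
def stoppingTimes : Set (Ω → WithTop ℝ≥0) :=
  {σ | IsStoppingTime P.filtration σ ∧ ∀ᵐ ω ∂μ, σ ω ≠ ⊤}

open Classical in
/-- The σ-algebra `F_{T_n}` of the observed events prior to the jump time `T_n`. Under the
assumptions above, `T_n` always is a stopping time of the observed filtration (consecutive
observations differ almost surely, the noise having a density); the other branch is only there
because the definition needs a value before this is proved. -/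
@[reducible] def filtrationT (n : ℕ) : MeasurableSpace Ω :=
  if h : IsStoppingTime P.filtration (fun ω => ((P.T n ω : ℝ≥0) : WithTop ℝ≥0)) then
    h.measurableSpace
  else ⊥

/-- The filter `Π_n^i = E[1_{Z_n = x_i} | F_{T_n}]`. -/
def filter (n : ℕ) (i : Fin q) : Ω → ℝ :=
  μ[{ω | P.Z n ω = M.pt i}.indicator (fun _ => (1 : ℝ)) | P.filtrationT n]

/-- The event `{Π_0 = π'}`. -/
def filterZeroEq (π' : Fin q → ℝ) : Set Ω := {ω | ∀ i, P.filter 0 i ω = π' i}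

/-- `(R_n)` is a sequence of nonnegative random variables describing the stopping time `σ` between
the jumps: `R_n` is `F_{T_n}`-measurable and `σ ∧ T_{n+1} = (T_n + R_n) ∧ T_{n+1}` on the event
`{σ ≥ T_n}`, almost surely. -/
def IsAssociated (σ : Ω → WithTop ℝ≥0) (R : ℕ → Ω → ℝ≥0) : Prop :=
  ∀ n, Measurable[P.filtrationT n] (R n) ∧
    ∀ᵐ ω ∂μ, ((P.T n ω : ℝ≥0) : WithTop ℝ≥0) ≤ σ ω →
      min (σ ω) ((P.T (n + 1) ω : ℝ≥0) : WithTop ℝ≥0)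
        = ((min (P.T n ω + R n ω) (P.T (n + 1) ω) : ℝ≥0) : WithTop ℝ≥0)

/-- The state `X_{σ ∧ T_n}`. -/
def stoppedState (σ : Ω → WithTop ℝ≥0) (n : ℕ) : Ω → EuclideanSpace ℝ (Fin d) :=
  stoppedValue P.X (fun ω => min (σ ω) ((P.T n ω : ℝ≥0) : WithTop ℝ≥0))

/-- The variable `1_{T_k ≤ σ} 1_{R_k < t^*_i} g(Φ(x_i, R_k)) e^{-Λ(x_i, R_k)} Π_k^i`. -/
def runningTerm (g : EuclideanSpace ℝ (Fin d) → ℝ) (σ : Ω → WithTop ℝ≥0) (R : ℕ → Ω → ℝ≥0)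
    (k : ℕ) (i : Fin q) : Ω → ℝ :=
  ({ω | ((P.T k ω : ℝ≥0) : WithTop ℝ≥0) ≤ σ ω} ∩
      {ω | (R k ω : ℝ≥0∞) < M.exitTime (M.pt i)}).indicator
    fun ω => g (M.flow (M.pt i) (R k ω)) * Real.exp (-M.cumRate (M.pt i) (R k ω)) * P.filter k i ω

/-- The variable `1_{T_n ≤ σ} g(x_i) Π_n^i`. -/
def terminalTerm (g : EuclideanSpace ℝ (Fin d) → ℝ) (σ : Ω → WithTop ℝ≥0)
    (n : ℕ) (i : Fin q) : Ω → ℝ :=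
  {ω | ((P.T n ω : ℝ≥0) : WithTop ℝ≥0) ≤ σ ω}.indicator
    fun ω => g (M.pt i) * P.filter n i ω

end ObservedPDMP.Realization

end

noncomputable section

/-! Almost surely the stopped path is frozen in exactly one way: either σ falls in some [T_k,
T_{k+1}) with k < n, which amounts to T_k ≤ σ and R_k < S_{k+1}, and the state is Φ(Z_k, R_k); or
T_n ≤ σ and the state is Z_n. Integrating this identity (`apply_stoppedState_eq_sum`) and splitting
over the values x_i of Z_k reduces the formula to two substitutions: the indicator of {R_k <
S_{k+1}} by the survival function of x_i at R_k, then the indicator of {Z_k = x_i} by the filter.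
The second one is the definition of conditional expectation, since the other factors are
F_{T_k}-measurable.

The first one needs the law of S_{k+1} given F_{T_k} on {Z_k = x_i}, whereas the model gives it only
relative to the past of the chain. Up to null sets, an event of F_{T_k} depends only on T_0, Y_0, …,
T_k, Y_k (`filtrationT_le_eventuallyMeasurableSpace`), hence on the past of the chain and on the
noise. The noise is independent of the whole chain, so adding it to the conditioning changes nothing
(`condExp_sup_of_indep`). This gives `measureReal_inter_lt_S_filtrationT`, and
`setIntegral_mul_indicator_lt` then puts the random time R_k in place of a fixed t.

All this presupposes that the jump times are stopping times of the observed filtration: a jump is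
visible because the noise has no atoms, so consecutive observations almost surely differ. The
sequence R_k exists because, before T_{k+1}, each event {σ ≤ t} agrees almost surely with an event
of the observed past up to T_k. That past is trivial for k = 0, so Π_0 = π almost surely and
conditioning on this event leaves the measure unchanged. -/

/-- The extension by zero of a function measurable on a measurable set is measurable. -/
theorem Measurable.indicator_of_domRestrict {α : Type*} [MeasurableSpace α] {s : Set α}
    (hs : MeasurableSet s) {f : α → ℝ} (hf : Measurable (s.domRestrict f)) :
    Measurable (s.indicator f) := by
  refine measurable_of_restrict_of_restrict_compl hs ?_ ?_
  · have : s.domRestrict (s.indicator f) = s.domRestrict f := by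
      funext x
      simp [Set.domRestrict]
    rwa [this]
  · have : sᶜ.domRestrict (s.indicator f) = fun _ => 0 := by
      funext x
      exact Set.indicator_of_notMem x.2 _
    rw [this]
    exact measurable_const

/-! ### The flow up to the exit time, and the survival function -/

namespace PDMP

variable {d : ℕ} (M : PDMP d)

theorem flow_zero (x : EuclideanSpace ℝ (Fin d)) : M.flow x 0 = x :=
  ((M.isHomeomorph_flow 0).injective (by simpa using M.flow_add x 0 0)).symm

theorem continuous_flow_right (x : EuclideanSpace ℝ (Fin d)) : Continuous (M.flow x) :=
  M.continuous_flow.comp (Continuous.prodMk_right x)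

variable {M}

/-- A trajectory is connected, so it cannot leave the open set E without meeting the frontier, which
it does not do at positive times before t^*. -/
theorem flow_mem_of_lt_exitTime {x : EuclideanSpace ℝ (Fin d)} (hx : x ∈ M.E) {t : ℝ≥0}
    (ht : (t : ℝ≥0∞) < M.exitTime x) : M.flow x t ∈ M.E := by
  have hsub : M.flow x '' Icc 0 t ⊆ M.E := by
    refine (isPreconnected_Icc.image _
      (M.continuous_flow_right x).continuousOn).subset_of_closure_inter_subset M.isOpen_E ?_ ?_
    · exact ⟨x, ⟨0, ⟨le_rfl, zero_le⟩, M.flow_zero x⟩, hx⟩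
    · rintro _ ⟨hcl, s, ⟨-, hst⟩, rfl⟩
      by_contra hE
      have hs0 : 0 < s := by
        rcases eq_or_ne s 0 with rfl | h
        · exact absurd hx (by rwa [M.flow_zero] at hE)
        · exact pos_iff_ne_zero.2 h
      have hfr : M.flow x s ∈ frontier M.E := by
        rw [M.isOpen_E.frontier_eq]
        exact ⟨hcl, hE⟩
      have : M.exitTime x ≤ s := sInf_le ⟨s, ⟨hs0, hfr⟩, rfl⟩
      exact absurd (ht.trans_le this) (not_lt.2 (by exact_mod_cast hst))
  exact hsub ⟨t, ⟨zero_le, le_rfl⟩, rfl⟩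

theorem flow_mem_closure_of_le_exitTime {x : EuclideanSpace ℝ (Fin d)} (hx : x ∈ M.E) {t : ℝ≥0}
    (ht : (t : ℝ≥0∞) ≤ M.exitTime x) : M.flow x t ∈ closure M.E := by
  rcases eq_or_ne t 0 with rfl | h0
  · rw [M.flow_zero]
    exact subset_closure hx
  have hmaps : MapsTo (M.flow x) (Iio t) M.E := fun s hs =>
    flow_mem_of_lt_exitTime hx (lt_of_lt_of_le (by exact_mod_cast hs) ht)
  have hcl : t ∈ closure (Iio t) := by
    rw [closure_Iio' ⟨0, pos_iff_ne_zero.2 h0⟩]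
    exact self_mem_Iic
  exact hmaps.closure (M.continuous_flow_right x) hcl

section Rate

variable (hC : ∃ C, ∀ x ∈ closure M.E, M.rate x ≤ C) {x : EuclideanSpace ℝ (Fin d)}
  (hx : x ∈ M.E)

include hx in
theorem rate_flow_nonneg {t s : ℝ≥0} (ht : (t : ℝ≥0∞) < M.exitTime x) (hst : s ≤ t) :
    0 ≤ M.rate (M.flow x s) :=
  M.rate_nonneg _ (subset_closure (flow_mem_of_lt_exitTime hx
    (lt_of_le_of_lt (by exact_mod_cast hst) ht)))

include hC hx in
theorem intervalIntegrable_rate_flow {t : ℝ≥0} (ht : (t : ℝ≥0∞) < M.exitTime x) :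
    IntervalIntegrable (fun s : ℝ => M.rate (M.flow x s.toNNReal)) volume 0 t := by
  obtain ⟨C, hC⟩ := hC
  have hmem : ∀ s ∈ Ioc (0 : ℝ) t, M.flow x s.toNNReal ∈ closure M.E := fun s hs =>
    subset_closure (flow_mem_of_lt_exitTime hx (lt_of_le_of_lt
      (by exact_mod_cast Real.toNNReal_le_iff_le_coe.2 hs.2) ht))
  refine (intervalIntegrable_iff_integrableOn_Ioc_of_le t.2).2 ?_
  have hm : Measurable fun s : ℝ => (closure M.E).indicator M.rate (M.flow x s.toNNReal) :=
    (M.measurable_rate.indicator_of_domRestrict isClosed_closure.measurableSet).comp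
      ((M.continuous_flow_right x).measurable.comp measurable_real_toNNReal)
  have hI : IntegrableOn (fun s : ℝ => (closure M.E).indicator M.rate (M.flow x s.toNNReal))
      (Ioc 0 t) := by
    refine IntegrableOn.of_bound (by simp) hm.aestronglyMeasurable C ?_
    filter_upwards [ae_restrict_mem measurableSet_Ioc] with s hs
    rw [indicator_of_mem (hmem s hs), Real.norm_of_nonneg (M.rate_nonneg _ (hmem s hs))]
    exact hC _ (hmem s hs)
  exact hI.congr_fun (fun s hs => indicator_of_mem (hmem s hs) _) measurableSet_Ioc

include hx in
theorem cumRate_nonneg {t : ℝ≥0} (ht : (t : ℝ≥0∞) < M.exitTime x) : 0 ≤ M.cumRate x t :=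
  intervalIntegral.integral_nonneg t.2 fun _ hs =>
    rate_flow_nonneg hx ht (Real.toNNReal_le_iff_le_coe.2 hs.2)

include hC hx in
theorem cumRate_mono {s t : ℝ≥0} (hst : s ≤ t) (ht : (t : ℝ≥0∞) < M.exitTime x) :
    M.cumRate x s ≤ M.cumRate x t := by
  refine intervalIntegral.integral_mono_interval le_rfl s.2 (by exact_mod_cast hst) ?_
    (intervalIntegrable_rate_flow hC hx ht)
  filter_upwards [ae_restrict_mem measurableSet_Ioc] with r hr
  exact rate_flow_nonneg hx ht (Real.toNNReal_le_iff_le_coe.2 hr.2)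

variable (M) in
theorem survival_nonneg (x : EuclideanSpace ℝ (Fin d)) (t : ℝ≥0) : 0 ≤ M.survival x t := by
  unfold survival
  split_ifs
  · exact (Real.exp_pos _).le
  · exact le_rfl

include hx in
theorem survival_le_one (t : ℝ≥0) : M.survival x t ≤ 1 := by
  unfold survival
  split_ifs with h
  · exact Real.exp_le_one_iff.2 (neg_nonpos.2 (cumRate_nonneg hx h))
  · exact zero_le_one

include hC hx in
-- Monotonicity is what later provides measurability in t.
theorem antitone_survival : Antitone (M.survival x) := by
  intro s t hst
  by_cases ht : (t : ℝ≥0∞) < M.exitTime x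
  · have hs : (s : ℝ≥0∞) < M.exitTime x := lt_of_le_of_lt (by exact_mod_cast hst) ht
    rw [survival, survival, if_pos ht, if_pos hs]
    exact Real.exp_le_exp.2 (neg_le_neg (cumRate_mono hC hx hst ht))
  · conv_lhs => rw [survival, if_neg ht]
    exact M.survival_nonneg x s

end Rate

theorem survival_zero {x : EuclideanSpace ℝ (Fin d)} (hx : 0 < M.exitTime x) :
    M.survival x 0 = 1 := by
  simp [survival, hx, cumRate]

end PDMP

/-! ### Almost sure behaviour of the chain and of the observations -/

/-- A random variable whose law has no atoms almost surely differs from any independent one. -/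
theorem ProbabilityTheory.IndepFun.ae_ne {Ω α : Type*} {mΩ : MeasurableSpace Ω} {μ : Measure Ω}
    [IsFiniteMeasure μ] [MeasurableSpace α] [MeasurableEq α] {V W : Ω → α}
    (h : IndepFun V W μ) (hV : Measurable V) (hW : Measurable W)
    (hatom : ∀ x, μ.map W {x} = 0) : ∀ᵐ ω ∂μ, V ω ≠ W ω := by
  have hdiag : MeasurableSet {p : α × α | p.1 = p.2} := measurableSet_diagonal
  have hprod := (indepFun_iff_map_prod_eq_prod_map_map hV.aemeasurable hW.aemeasurable).1 h
  have hnull : μ.map (fun ω => (V ω, W ω)) {p | p.1 = p.2} = 0 := by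
    rw [hprod, Measure.measure_prod_null hdiag]
    refine Filter.Eventually.of_forall fun x => ?_
    have : Prod.mk x ⁻¹' {p : α × α | p.1 = p.2} = {x} := by
      ext y
      simp [eq_comm]
    change μ.map W (Prod.mk x ⁻¹' {p : α × α | p.1 = p.2}) = 0
    rw [this]
    exact hatom x
  rw [Measure.map_apply (hV.prodMk hW) hdiag] at hnull
  rw [ae_iff]
  simpa using hnull

theorem MeasureTheory.measureReal_eq_one_iff_ae {Ω : Type*} {mΩ : MeasurableSpace Ω}
    {μ : Measure Ω} [IsProbabilityMeasure μ] {p : Ω → Prop} (hp : MeasurableSet {ω | p ω}) :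
    μ.real {ω | p ω} = 1 ↔ ∀ᵐ ω ∂μ, p ω := by
  rw [measureReal_def, ENNReal.toReal_eq_one_iff]
  exact prob_compl_eq_zero_iff hp |>.symm

namespace ObservedPDMP

variable {d q : ℕ} {M : ObservedPDMP d q}

/-- A finite exit time provides a frontier point, distinct from x_i because E is open. This excludes
d = 0, where Lebesgue measure has an atom and the noise could hide a jump. -/
theorem nontrivial_space (M : ObservedPDMP d q) (i : Fin q) :
    Nontrivial (EuclideanSpace ℝ (Fin d)) := by
  have hne : {t : ℝ≥0 | 0 < t ∧ M.flow (M.pt i) t ∈ frontier M.E}.Nonempty := by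
    by_contra h
    have h' := M.exitTime_lt_top i
    rw [PDMP.exitTime, not_nonempty_iff_eq_empty.1 h] at h'
    simp at h'
  obtain ⟨t, -, ht⟩ := hne
  rw [M.isOpen_E.frontier_eq] at ht
  exact ⟨⟨M.flow (M.pt i) t, M.pt i, fun h => ht.2 (by rw [h]; exact M.pt_mem i)⟩⟩

namespace Realization

variable {π : Fin q → ℝ} {Ω : Type*} {mΩ : MeasurableSpace Ω}
  {μ : Measure Ω} (P : M.Realization π μ)

theorem chainPast_le (n : ℕ) : chainPast P.Z P.S n ≤ mΩ :=
  (measurable_pi_lambda _ fun k : Fin (n + 1) =>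
    (P.measurable_Z k).prodMk (P.measurable_S k)).comap_le

theorem measurable_Z_chainPast {j n : ℕ} (h : j ≤ n) : Measurable[chainPast P.Z P.S n] (P.Z j) := by
  have h1 : Measurable fun z : Fin (n + 1) → EuclideanSpace ℝ (Fin d) × ℝ≥0 =>
      (z ⟨j, Nat.lt_succ_of_le h⟩).1 := by fun_prop
  exact h1.comp (comap_measurable _)

theorem measurable_S_chainPast {j n : ℕ} (h : j ≤ n) : Measurable[chainPast P.Z P.S n] (P.S j) := by
  have h1 : Measurable fun z : Fin (n + 1) → EuclideanSpace ℝ (Fin d) × ℝ≥0 =>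
      (z ⟨j, Nat.lt_succ_of_le h⟩).2 := by fun_prop
  exact h1.comp (comap_measurable _)

theorem measurableSet_Z_eq (n : ℕ) (x : EuclideanSpace ℝ (Fin d)) :
    MeasurableSet {ω | P.Z n ω = x} :=
  P.measurable_Z n (measurableSet_singleton x)

theorem measurableSet_lt_S (n : ℕ) (t : ℝ≥0) : MeasurableSet {ω | t < P.S n ω} :=
  P.measurable_S n measurableSet_Ioi

theorem T_succ (n : ℕ) (ω : Ω) : P.T (n + 1) ω = P.T n ω + P.S (n + 1) ω := by
  simp [T, Finset.sum_range_succ]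

theorem T_zero (ω : Ω) : P.T 0 ω = 0 := by
  simp [T]

theorem map_W_singleton (i : Fin q) (n : ℕ) (x : EuclideanSpace ℝ (Fin d)) :
    μ.map (P.W (n + 1)) {x} = 0 := by
  have := M.nontrivial_space i
  rw [P.law_W n]
  exact withDensity_absolutelyContinuous _ _ (measure_singleton x)

variable [IsProbabilityMeasure μ]

theorem measureReal_inter_lt_S {n : ℕ} (t : ℝ≥0) {B : Set Ω}
    (hB : MeasurableSet[chainPast P.Z P.S n] B) :
    μ.real (B ∩ {ω | t < P.S (n + 1) ω}) = ∫ ω in B, M.survival (P.Z n ω) t ∂μ := by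
  have hS := P.measurableSet_lt_S (n + 1) t
  have hint : Integrable ({ω | t < P.S (n + 1) ω}.indicator fun _ => (1 : ℝ)) μ :=
    (integrable_const _).indicator hS
  rw [← setIntegral_congr_ae (P.chainPast_le n _ hB) ((P.law_S n t).mono fun ω h _ => h),
    setIntegral_condExp (P.chainPast_le n) hint hB, integral_indicator hS, setIntegral_const,
    measureReal_restrict_apply hS, smul_eq_mul, mul_one, inter_comm]

theorem ae_S_pos_of_ae_Z_mem {n : ℕ} (hZ : ∀ᵐ ω ∂μ, P.Z n ω ∈ range M.pt) :
    ∀ᵐ ω ∂μ, 0 < P.S (n + 1) ω := by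
  rw [← measureReal_eq_one_iff_ae (P.measurableSet_lt_S _ _)]
  have h := P.measureReal_inter_lt_S (n := n) 0 MeasurableSet.univ
  rw [univ_inter, setIntegral_univ] at h
  rw [h, integral_congr_ae (g := fun _ => (1 : ℝ)) ?_]
  · simp
  · filter_upwards [hZ] with ω hω
    obtain ⟨i, hi⟩ := hω
    rw [← hi]
    exact PDMP.survival_zero (M.exitTime_pos i)

theorem ae_S_le_exitTime_of_ae_Z_mem {n : ℕ} (hZ : ∀ᵐ ω ∂μ, P.Z n ω ∈ range M.pt) :
    ∀ᵐ ω ∂μ, (P.S (n + 1) ω : ℝ≥0∞) ≤ M.exitTime (P.Z n ω) := by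
  have key : ∀ i, ∀ᵐ ω ∂μ, P.Z n ω = M.pt i → (P.S (n + 1) ω : ℝ≥0∞) ≤ M.exitTime (M.pt i) := by
    intro i
    -- The exit time is finite, so the law of S can be tested at t = t^* itself, where the survival
    -- function vanishes.
    lift M.exitTime (M.pt i) to ℝ≥0 using (M.exitTime_lt_top i).ne with t ht
    have hB : MeasurableSet[chainPast P.Z P.S n] {ω | P.Z n ω = M.pt i} :=
      P.measurable_Z_chainPast le_rfl (measurableSet_singleton _)
    have h := P.measureReal_inter_lt_S t hB
    rw [setIntegral_congr_fun (g := fun _ => (0 : ℝ)) (P.chainPast_le n _ hB), integral_zero,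
      measureReal_eq_zero_iff] at h
    · rw [ae_iff]
      refine measure_mono_null (fun ω hω => ?_) h
      simp only [mem_ofPred_eq, Classical.not_imp, not_le] at hω
      exact ⟨hω.1, by exact_mod_cast hω.2⟩
    · intro ω hω
      have : P.Z n ω = M.pt i := hω
      simp [PDMP.survival, this, ← ht]
  filter_upwards [hZ, ae_all_iff.2 key] with ω ⟨i, hi⟩ h
  rw [← hi]
  exact h i hi.symm

/-- The bound S ≤ t^* places the pre-jump position in the closure of E, the only region where Q is
known to charge E₀ fully. -/
theorem ae_Z_succ_mem_of_ae_Z_mem {n : ℕ} (hZ : ∀ᵐ ω ∂μ, P.Z n ω ∈ range M.pt) :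
    ∀ᵐ ω ∂μ, P.Z (n + 1) ω ∈ range M.pt := by
  have hrange : MeasurableSet (range M.pt) := (finite_range _).measurableSet
  have hle : chainPast P.Z P.S n ⊔ MeasurableSpace.comap (P.S (n + 1)) inferInstance ≤ mΩ :=
    sup_le (P.chainPast_le n) (P.measurable_S _).comap_le
  have hmeas : MeasurableSet {ω | P.Z (n + 1) ω ∈ range M.pt} := P.measurable_Z _ hrange
  rw [← measureReal_eq_one_iff_ae hmeas]
  have h := integral_condExp (μ := μ)
    (f := {ω | P.Z (n + 1) ω ∈ range M.pt}.indicator fun _ => (1 : ℝ)) hle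
  rw [integral_indicator hmeas, setIntegral_const, smul_eq_mul, mul_one] at h
  rw [← h, integral_congr_ae (P.law_Z n _ hrange), integral_congr_ae (g := fun _ => (1 : ℝ)) ?_]
  · simp
  · filter_upwards [hZ, P.ae_S_le_exitTime_of_ae_Z_mem hZ] with ω ⟨i, hi⟩ hS
    rw [← hi] at hS ⊢
    simp [measureReal_def,
      M.Q_range _ (PDMP.flow_mem_closure_of_le_exitTime (M.pt_mem i) hS)]

section Simplex

variable (hπ : π ∈ stdSimplex ℝ (Fin q))

include hπ in
theorem ae_Z_mem (n : ℕ) : ∀ᵐ ω ∂μ, P.Z n ω ∈ range M.pt := by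
  induction n with
  | zero =>
    have hrange : MeasurableSet (range M.pt) := (finite_range _).measurableSet
    rw [← measureReal_eq_one_iff_ae (P.measurable_Z 0 hrange)]
    have : {ω | P.Z 0 ω ∈ range M.pt} = ⋃ i, {ω | P.Z 0 ω = M.pt i} := by
      ext ω
      simp [eq_comm]
    rw [this, measureReal_iUnion_fintype ?_ fun i => P.measurableSet_Z_eq 0 _]
    · simp only [P.law_Z_zero, hπ.2]
    · intro i j hij
      refine disjoint_left.2 fun ω hi hj => hij (M.pt_injective ?_)
      exact Eq.trans (Eq.symm hi) hj
  | succ n ih => exact P.ae_Z_succ_mem_of_ae_Z_mem ih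

include hπ in
theorem ae_S_pos : ∀ᵐ ω ∂μ, ∀ n, 0 < P.S (n + 1) ω :=
  ae_all_iff.2 fun n => P.ae_S_pos_of_ae_Z_mem (P.ae_Z_mem hπ n)

include hπ in
theorem ae_S_le_exitTime (n : ℕ) : ∀ᵐ ω ∂μ, (P.S (n + 1) ω : ℝ≥0∞) ≤ M.exitTime (P.Z n ω) :=
  P.ae_S_le_exitTime_of_ae_Z_mem (P.ae_Z_mem hπ n)

include hπ in
theorem ae_T_lt_T_succ : ∀ᵐ ω ∂μ, ∀ n, P.T n ω < P.T (n + 1) ω := by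
  filter_upwards [P.ae_S_pos hπ] with ω h n
  rw [T_succ]
  exact lt_add_of_pos_right _ (h n)

include hπ in
theorem ae_Yobs_ne : ∀ᵐ ω ∂μ, ∀ n, P.Yobs n ω ≠ P.Yobs (n + 1) ω := by
  rw [ae_all_iff]
  intro n
  cases n with
  | zero =>
    have key : ∀ i, ∀ᵐ ω ∂μ, M.y0 - M.obs (M.pt i) ≠ P.W 1 ω := by
      intro i
      rw [ae_iff]
      have h := P.map_W_singleton i 0 (M.y0 - M.obs (M.pt i))
      rw [Measure.map_apply (P.measurable_W _) (measurableSet_singleton _)] at h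
      simpa [preimage, eq_comm] using h
    filter_upwards [P.ae_Z_mem hπ 1, ae_all_iff.2 key] with ω ⟨i, hi⟩ h heq
    simp only [Yobs, if_true, zero_add, one_ne_zero, if_false] at heq
    exact h i (by rw [hi, heq, add_sub_cancel_left])
  | succ n =>
    -- Freezing the values of Z at points of E₀ leaves two independent noises, so no independence
    -- between Z and W is needed here.
    have key : ∀ i j, ∀ᵐ ω ∂μ,
        M.obs (M.pt i) + P.W (n + 1) ω - M.obs (M.pt j) ≠ P.W (n + 2) ω := by
      intro i j
      have hind : IndepFun (P.W (n + 1)) (P.W (n + 2)) μ :=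
        P.iIndepFun_W.indepFun (i := n) (j := n + 1) (by simp)
      have hm : Measurable fun w : EuclideanSpace ℝ (Fin d) =>
          M.obs (M.pt i) + w - M.obs (M.pt j) := by fun_prop
      exact (hind.comp hm measurable_id).ae_ne (hm.comp (P.measurable_W _)) (P.measurable_W _)
        (P.map_W_singleton i (n + 1))
    filter_upwards [P.ae_Z_mem hπ (n + 1), P.ae_Z_mem hπ (n + 2),
      ae_all_iff.2 fun i => ae_all_iff.2 (key i)] with ω ⟨i, hi⟩ ⟨j, hj⟩ h heq
    simp only [Yobs, Nat.succ_ne_zero, if_false, add_assoc, Nat.reduceAdd] at heq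
    exact h i j (by rw [hi, hj, heq, add_sub_cancel_left])

end Simplex

end Realization

end ObservedPDMP

/-! ### The observed filtration at the jump times -/

/-- A countable set of times `s ≤ t` that contains `t` and is dense in `[0, t]`. -/
def denseTimesLE (t : ℝ≥0) : Set ℝ≥0 :=
  {s ∈ insert t (range (TopologicalSpace.denseSeq ℝ≥0)) | s ≤ t}

theorem countable_denseTimesLE (t : ℝ≥0) : (denseTimesLE t).Countable :=
  ((countable_range _).insert t).mono (sep_subset _ _)

theorem exists_mem_denseTimesLE {a b t : ℝ≥0} (hat : a ≤ t) (hab : a < b) :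
    ∃ s ∈ denseTimesLE t, a ≤ s ∧ s < b := by
  rcases lt_or_ge t b with h | h
  · exact ⟨t, ⟨mem_insert _ _, le_rfl⟩, hat, h⟩
  · obtain ⟨s, hs, h1, h2⟩ := (TopologicalSpace.denseRange_denseSeq ℝ≥0).exists_between hab
    exact ⟨s, ⟨mem_insert_of_mem _ hs, h2.le.trans h⟩, h1.le, h2⟩

theorem tsum_indicator_Ico_of_mem {β : Type*} [AddCommMonoid β] [TopologicalSpace β]
    {T : ℕ → ℝ≥0} (hT : Monotone T) (f : ℕ → ℝ≥0 → β) {t : ℝ≥0} {j : ℕ}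
    (h1 : T j ≤ t) (h2 : t < T (j + 1)) :
    ∑' k, (Ico (T k) (T (k + 1))).indicator (f k) t = f j t := by
  rw [tsum_eq_single j, indicator_of_mem (show t ∈ Ico _ _ from ⟨h1, h2⟩)]
  intro k hk
  refine indicator_of_notMem (fun h => ?_) _
  rcases lt_or_gt_of_ne hk with hlt | hlt
  · exact absurd (h.2.trans_le ((hT hlt).trans h1)) (lt_irrefl _)
  · exact absurd (h2.trans_le ((hT hlt).trans h.1)) (lt_irrefl _)

namespace ObservedPDMP.Realization

variable {d q : ℕ} {M : ObservedPDMP d q} {π : Fin q → ℝ} {Ω : Type*} {mΩ : MeasurableSpace Ω}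
  {μ : Measure Ω} (P : M.Realization π μ)

theorem Y_eq {t : ℝ≥0} {j : ℕ} {ω : Ω} (h1 : P.T j ω ≤ t) (h2 : t < P.T (j + 1) ω) :
    P.Y t ω = P.Yobs j ω :=
  tsum_indicator_Ico_of_mem (P.monotone_T ω) (fun j _ => P.Yobs j ω) h1 h2

theorem X_eq {t : ℝ≥0} {j : ℕ} {ω : Ω} (h1 : P.T j ω ≤ t) (h2 : t < P.T (j + 1) ω) :
    P.X t ω = M.flow (P.Z j ω) (t - P.T j ω) :=
  tsum_indicator_Ico_of_mem (P.monotone_T ω) (fun j s => M.flow (P.Z j ω) (s - P.T j ω)) h1 h2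

/-- Only times before T_{k+1} are considered, so explosion of the jump times need not be excluded.
-/
theorem exists_T_le_lt {t : ℝ≥0} {k : ℕ} {ω : Ω} (h : t < P.T (k + 1) ω) :
    ∃ j ≤ k, P.T j ω ≤ t ∧ t < P.T (j + 1) ω := by
  induction k with
  | zero => exact ⟨0, le_rfl, by simp [P.T_zero], h⟩
  | succ k ih =>
    rcases lt_or_ge t (P.T (k + 1) ω) with h' | h'
    · obtain ⟨j, hj, h1⟩ := ih h'
      exact ⟨j, hj.trans k.le_succ, h1⟩
    · exact ⟨k + 1, le_rfl, h', h⟩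

theorem measurable_Y_filtration {s t : ℝ≥0} (hst : s ≤ t) :
    Measurable[P.filtration t] (P.Y s) := by
  refine measurable_iff_comap_le.2 (le_sup_of_le_left ?_)
  exact le_iSup₂_of_le (f := fun r (_ : r ≤ t) =>
    MeasurableSpace.comap (P.Y r) inferInstance) s hst le_rfl

/-- The completion of the filtration is used here: observed events may be identified almost surely
only. -/
theorem measurableSet_filtration_of_ae_eq {t : ℝ≥0} {A B : Set Ω} (hA : MeasurableSet A)
    (hB : MeasurableSet[P.filtration t] B) (h : A =ᵐ[μ] B) : MeasurableSet[P.filtration t] A := by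
  have hnull : ∀ N : Set Ω, MeasurableSet N → μ N = 0 → MeasurableSet[P.filtration t] N := by
    intro N hN h0
    have hle : MeasurableSpace.generateFrom {A | MeasurableSet A ∧ μ A = 0} ≤ P.filtration t :=
      le_sup_right
    exact hle _ (MeasurableSpace.measurableSet_generateFrom ⟨hN, h0⟩)
  have hB' : MeasurableSet B := P.filtration.le t _ hB
  have h1 := hnull _ (hB'.diff hA) (ae_le_set.1 h.symm.le)
  have h2 := hnull _ (hA.diff hB') (ae_le_set.1 h.le)
  have : A = (B \ (B \ A)) ∪ (A \ B) := by
    ext ω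
    simp only [mem_union, mem_sdiff]
    tauto
  rw [this]
  exact (hB.diff h1).union h2

theorem measurableSet_T_le (n : ℕ) (t : ℝ≥0) : MeasurableSet {ω | P.T n ω ≤ t} :=
  P.measurable_T n measurableSet_Iic

theorem measurableSet_T_le_lt (k : ℕ) (t : ℝ≥0) :
    MeasurableSet {ω | P.T k ω ≤ t ∧ t < P.T (k + 1) ω} :=
  (P.measurable_T k measurableSet_Iic).inter (P.measurable_T (k + 1) measurableSet_Ioi)

/-- The past `σ(T_0, Y_0, …, T_k, Y_k)` of the observed marked point process. -/
@[reducible] def observedPast (k : ℕ) : MeasurableSpace Ω :=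
  ⨆ j, ⨆ _ : j ≤ k, MeasurableSpace.comap (P.T j) inferInstance ⊔
    MeasurableSpace.comap (P.Yobs j) inferInstance

theorem measurable_T_observedPast {j k : ℕ} (h : j ≤ k) : Measurable[P.observedPast k] (P.T j) :=
  measurable_iff_comap_le.2 (le_iSup₂_of_le (f := fun j (_ : j ≤ k) =>
    MeasurableSpace.comap (P.T j) inferInstance ⊔ MeasurableSpace.comap (P.Yobs j) inferInstance)
    j h le_sup_left)

theorem measurable_Yobs_observedPast {j k : ℕ} (h : j ≤ k) :
    Measurable[P.observedPast k] (P.Yobs j) :=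
  measurable_iff_comap_le.2 (le_iSup₂_of_le (f := fun j (_ : j ≤ k) =>
    MeasurableSpace.comap (P.T j) inferInstance ⊔ MeasurableSpace.comap (P.Yobs j) inferInstance)
    j h le_sup_right)

/-- Before the jump time `T_{k+1}`, the observed events are functions of the past of the observed
marked point process, up to a null set. -/
theorem filtration_le_eventuallyMeasurableSpace (k : ℕ) (t : ℝ≥0) :
    (P.filtration t : MeasurableSpace Ω) ≤ eventuallyMeasurableSpace (P.observedPast k)
      (ae (μ.restrict {ω | P.T k ω ≤ t ∧ t < P.T (k + 1) ω})) := by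
  have hC := P.measurableSet_T_le_lt k t
  refine sup_le (iSup₂_le fun s hs => ?_) (MeasurableSpace.generateFrom_le fun A hA => ?_)
  · rintro _ ⟨U, hU, rfl⟩
    -- For j = k the bound s < T_{k+1} is not an event of the past up to k; it may be dropped
    -- because it holds on the restricting event.
    refine ⟨⋃ j, ⋃ (_ : j ≤ k), {ω | P.T j ω ≤ s} ∩ {ω | j = k ∨ s < P.T (j + 1) ω} ∩
      P.Yobs j ⁻¹' U, ?_, ?_⟩
    · refine MeasurableSet.iUnion fun j => MeasurableSet.iUnion fun hj => ?_
      refine MeasurableSet.inter (MeasurableSet.inter ?_ ?_) (P.measurable_Yobs_observedPast hj hU)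
      · exact P.measurable_T_observedPast hj measurableSet_Iic
      · by_cases hjk : j = k
        · simp [hjk]
        · simp only [hjk, false_or]
          exact P.measurable_T_observedPast (by omega : j + 1 ≤ k) measurableSet_Ioi
    · rw [Filter.eventuallyEq_set]
      filter_upwards [ae_restrict_mem hC] with ω ⟨_, hω⟩
      simp only [mem_iUnion, mem_inter_iff, mem_preimage, mem_ofPred_eq]
      constructor
      · intro hY
        obtain ⟨j, hj, h1, h2⟩ := P.exists_T_le_lt (hs.trans_lt hω)
        exact ⟨j, hj, ⟨h1, Or.inr h2⟩, by rwa [← P.Y_eq h1 h2]⟩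
      · rintro ⟨j, hj, ⟨h1, h2⟩, hY⟩
        have h2' : s < P.T (j + 1) ω := by
          rcases h2 with rfl | h2
          · exact hs.trans_lt hω
          · exact h2
        rwa [P.Y_eq h1 h2']
  · refine ⟨∅, @MeasurableSet.empty _ (P.observedPast k), ?_⟩
    exact ae_eq_empty.2 (Measure.absolutelyContinuous_of_le Measure.restrict_le_self hA.2)

variable [IsProbabilityMeasure μ] (hπ : π ∈ stdSimplex ℝ (Fin q))

include hπ in
/-- The jump times are stopping times of the observed filtration. -/
theorem isStoppingTime_T (n : ℕ) :
    IsStoppingTime P.filtration fun ω => ((P.T n ω : ℝ≥0) : WithTop ℝ≥0) := by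
  induction n with
  | zero =>
    intro t
    simp [P.T_zero]
  | succ n ih =>
    intro t
    simp only [IsStoppingTime, WithTop.coe_le_coe] at ih ⊢
    refine P.measurableSet_filtration_of_ae_eq (P.measurableSet_T_le _ _)
      -- T_{n+1} ≤ t exactly when Y takes two different values at times s ≤ r ≤ t after T_n. The
      -- countable set contains t, which catches the case T_{n+1} = t.
      (B := ⋃ s ∈ denseTimesLE t, ⋃ r ∈ denseTimesLE t, {ω | P.T n ω ≤ s} ∩ {_ω | s ≤ r} ∩
        {ω | P.Y r ω = P.Y s ω}ᶜ) ?_ ?_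
    · refine MeasurableSet.biUnion (countable_denseTimesLE t) fun s hs =>
        MeasurableSet.biUnion (countable_denseTimesLE t) fun r hr => ?_
      refine MeasurableSet.inter (MeasurableSet.inter (P.filtration.mono hs.2 _ (ih s))
        (MeasurableSet.const _)) (MeasurableSet.compl ?_)
      exact @measurableSet_eq_fun _ _ (P.filtration t) _ _ _ _
        (P.measurable_Y_filtration hr.2) (P.measurable_Y_filtration hs.2)
    · rw [Filter.eventuallyEq_set]
      filter_upwards [P.ae_T_lt_T_succ hπ, P.ae_Yobs_ne hπ] with ω hT hY
      simp only [mem_iUnion, mem_inter_iff, mem_ofPred_eq, mem_compl_iff, exists_prop]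
      constructor
      · intro ht
        obtain ⟨s, hs, h1, h2⟩ := exists_mem_denseTimesLE ((hT n).le.trans ht) (hT n)
        obtain ⟨r, hr, h3, h4⟩ := exists_mem_denseTimesLE ht (hT (n + 1))
        refine ⟨s, hs, r, hr, ⟨h1, h2.le.trans h3⟩, ?_⟩
        rw [P.Y_eq h1 h2, P.Y_eq h3 h4]
        exact (hY n).symm
      · rintro ⟨s, hs, r, hr, ⟨h1, h2⟩, h3⟩
        by_contra h
        have h4 : r < P.T (n + 1) ω := hr.2.trans_lt (not_le.1 h)
        exact h3 (by rw [P.Y_eq (h1.trans h2) h4, P.Y_eq h1 (h2.trans_lt h4)])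

include hπ in
theorem filtrationT_eq (n : ℕ) : P.filtrationT n = (P.isStoppingTime_T hπ n).measurableSpace :=
  dif_pos _

include hπ in
theorem measurableSet_filtrationT_iff {n : ℕ} {A : Set Ω} :
    MeasurableSet[P.filtrationT n] A ↔
      ∀ t : ℝ≥0, MeasurableSet[P.filtration t] (A ∩ {ω | P.T n ω ≤ t}) := by
  rw [P.filtrationT_eq hπ, IsStoppingTime.measurableSet]
  simp only [WithTop.coe_le_coe]
  refine ⟨And.right, fun h => ⟨?_, h⟩⟩
  have : A = ⋃ m : ℕ, A ∩ {ω | P.T n ω ≤ m} := by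
    ext ω
    simp only [mem_iUnion, mem_inter_iff, mem_ofPred_eq, exists_and_left]
    exact ⟨fun hω => ⟨hω, exists_nat_ge _⟩, And.left⟩
  rw [this]
  exact MeasurableSet.iUnion fun m => le_iSup P.filtration (m : ℝ≥0) _ (h m)

include hπ in
theorem filtrationT_le (n : ℕ) : P.filtrationT n ≤ mΩ := by
  rw [P.filtrationT_eq hπ]
  exact IsStoppingTime.measurableSpace_le _

include hπ in
theorem filtrationT_mono {j k : ℕ} (h : j ≤ k) : P.filtrationT j ≤ P.filtrationT k := by
  rw [P.filtrationT_eq hπ, P.filtrationT_eq hπ]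
  exact IsStoppingTime.measurableSpace_mono _ _ fun ω => WithTop.coe_le_coe.2 (P.monotone_T ω h)

include hπ in
theorem measurable_T_filtrationT (j : ℕ) : Measurable[P.filtrationT j] (P.T j) := by
  refine measurable_of_Iic (mδ := P.filtrationT j) fun a => ?_
  rw [P.measurableSet_filtrationT_iff hπ]
  intro t
  have h := P.isStoppingTime_T hπ j
  simp only [IsStoppingTime, WithTop.coe_le_coe] at h
  refine MeasurableSet.congr (P.filtration.mono (min_le_right a t) _ (h (min a t))) ?_
  ext ω
  simp

include hπ in
theorem measurable_Yobs_filtrationT (j : ℕ) : Measurable[P.filtrationT j] (P.Yobs j) := by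
  intro U hU
  rw [P.measurableSet_filtrationT_iff hπ]
  intro t
  have hle_T := P.isStoppingTime_T hπ
  simp only [IsStoppingTime, WithTop.coe_le_coe] at hle_T
  refine P.measurableSet_filtration_of_ae_eq
    ((P.measurable_Yobs j hU).inter (P.measurableSet_T_le j t))
    -- Y_j is read off from Y at a countable family of times in [T_j, T_{j+1}).
    (B := ⋃ s ∈ denseTimesLE t, {ω | P.T j ω ≤ s} ∩ {ω | P.T (j + 1) ω ≤ s}ᶜ ∩ P.Y s ⁻¹' U) ?_ ?_
  · refine MeasurableSet.biUnion (countable_denseTimesLE t) fun s hs => ?_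
    exact MeasurableSet.inter (MeasurableSet.inter (P.filtration.mono hs.2 _ (hle_T j s))
      (P.filtration.mono hs.2 _ (hle_T (j + 1) s)).compl) (P.measurable_Y_filtration hs.2 hU)
  · rw [Filter.eventuallyEq_set]
    filter_upwards [P.ae_T_lt_T_succ hπ] with ω hT
    simp only [mem_iUnion, mem_inter_iff, mem_ofPred_eq, mem_compl_iff, exists_prop, mem_preimage,
      not_le]
    constructor
    · rintro ⟨hY, ht⟩
      obtain ⟨s, hs, h1, h2⟩ := exists_mem_denseTimesLE ht (hT j)
      exact ⟨s, hs, ⟨h1, h2⟩, by rwa [P.Y_eq h1 h2]⟩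
    · rintro ⟨s, hs, ⟨h1, h2⟩, hY⟩
      exact ⟨by rwa [← P.Y_eq h1 h2], h1.trans hs.2⟩

include hπ in
theorem observedPast_le_filtrationT (k : ℕ) : P.observedPast k ≤ P.filtrationT k :=
  iSup₂_le fun j hj => (sup_le (P.measurable_T_filtrationT hπ j).comap_le
    (P.measurable_Yobs_filtrationT hπ j).comap_le).trans (P.filtrationT_mono hπ hj)

include hπ in
/-- The observed events prior to `T_k` are functions of the past of the observed marked point
process, up to a null set. -/
theorem filtrationT_le_eventuallyMeasurableSpace (k : ℕ) :
    P.filtrationT k ≤ eventuallyMeasurableSpace (P.observedPast k) (ae μ) := by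
  intro A hA
  have hB : ∀ t : ℝ≥0, ∃ B, MeasurableSet[P.observedPast k] B ∧
      ∀ᵐ ω ∂μ, P.T k ω ≤ t ∧ t < P.T (k + 1) ω → (ω ∈ A ↔ ω ∈ B) := by
    intro t
    obtain ⟨B, hB, hAB⟩ := P.filtration_le_eventuallyMeasurableSpace k t _
      ((P.measurableSet_filtrationT_iff hπ).1 hA t)
    refine ⟨B, hB, ?_⟩
    rw [Filter.eventuallyEq_set, ae_restrict_iff' (P.measurableSet_T_le_lt k t)] at hAB
    filter_upwards [hAB] with ω h hω
    rw [← h hω, mem_inter_iff, mem_ofPred_eq]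
    exact (and_iff_left hω.1).symm
  choose B hBm hB using hB
  -- Here `g m (N m ω)` is the first point strictly after T_k of the grid of mesh 1/(m+1). For large
  -- m it lies before T_{k+1}, where A agrees with the corresponding B; hence A is the lower limit
  -- over m of the events glued along the values of N.
  let g : ℕ → ℕ → ℝ≥0 := fun m j => (j + 1 : ℕ) / (m + 1 : ℕ)
  let N : ℕ → Ω → ℕ := fun m ω => ⌊P.T k ω * (m + 1 : ℕ)⌋₊
  refine ⟨⋃ m₀ : ℕ, ⋂ m : ℕ, ⋂ _ : m₀ ≤ m, ⋃ j : ℕ, {ω | N m ω = j} ∩ B (g m j), ?_, ?_⟩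
  · refine MeasurableSet.iUnion fun m₀ => MeasurableSet.iInter fun m => MeasurableSet.iInter
      fun _ => MeasurableSet.iUnion fun j => MeasurableSet.inter ?_ (hBm _)
    have h1 : Measurable fun t : ℝ≥0 => ⌊t * (m + 1 : ℕ)⌋₊ :=
      Nat.measurable_floor.comp (measurable_id.mul_const _)
    exact (h1.comp (P.measurable_T_observedPast le_rfl)) (measurableSet_singleton j)
  · rw [Filter.eventuallyEq_set]
    filter_upwards [P.ae_T_lt_T_succ hπ, ae_all_iff.2 fun m => ae_all_iff.2 fun j => hB (g m j)]
      with ω hT hω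
    have hgT : ∀ m, P.T k ω ≤ g m (N m ω) := by
      intro m
      have hm : (0 : ℝ≥0) < (m + 1 : ℕ) := by positivity
      rw [le_div_iff₀ hm]
      have := (Nat.lt_floor_add_one (P.T k ω * (m + 1 : ℕ))).le
      exact_mod_cast this
    have hgle : ∀ m, g m (N m ω) ≤ P.T k ω + 1 / (m + 1 : ℕ) := by
      intro m
      have hm : (0 : ℝ≥0) < (m + 1 : ℕ) := by positivity
      have hfl : ((N m ω : ℕ) : ℝ≥0) ≤ P.T k ω * (m + 1 : ℕ) := Nat.floor_le zero_le
      simp only [g]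
      rw [div_le_iff₀ hm, add_mul, one_div, inv_mul_cancel₀ hm.ne']
      push_cast at hfl ⊢
      gcongr
    obtain ⟨m₀, hm₀⟩ : ∃ m₀ : ℕ, ∀ m, m₀ ≤ m → g m (N m ω) < P.T (k + 1) ω := by
      have hpos : 0 < P.T (k + 1) ω - P.T k ω := tsub_pos_of_lt (hT k)
      obtain ⟨m₀, hm₀⟩ := exists_nat_one_div_lt (K := ℝ) (NNReal.coe_pos.2 hpos)
      have hm₀' : (1 : ℝ≥0) / (m₀ + 1 : ℕ) < P.T (k + 1) ω - P.T k ω := by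
        rw [← NNReal.coe_lt_coe]
        simpa using hm₀
      refine ⟨m₀, fun m hm => (hgle m).trans_lt ?_⟩
      have : (1 : ℝ≥0) / (m + 1 : ℕ) ≤ 1 / (m₀ + 1 : ℕ) := by gcongr
      rw [add_comm]
      exact lt_tsub_iff_right.1 (this.trans_lt hm₀')
    have hiff : ∀ m, m₀ ≤ m → (ω ∈ A ↔ ω ∈ ⋃ j : ℕ, {ω | N m ω = j} ∩ B (g m j)) := by
      intro m hm
      rw [hω m (N m ω) ⟨hgT m, hm₀ m hm⟩]
      simp
    simp only [mem_iUnion, mem_iInter]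
    constructor
    · intro hA
      exact ⟨m₀, fun m hm => by simpa using (hiff m hm).1 hA⟩
    · rintro ⟨m₁, h⟩
      exact (hiff (max m₀ m₁) (le_max_left _ _)).2
        (by simpa using h (max m₀ m₁) (le_max_right _ _))

end ObservedPDMP.Realization

/-! ### Independent enlargement of a σ-algebra, and substitution of a random time -/

theorem MeasurableSpace.generateFrom_inter_eq_sup {Ω : Type*} (m w : MeasurableSpace Ω) :
    MeasurableSpace.generateFrom (image2 (· ∩ ·) {a | MeasurableSet[m] a} {b | MeasurableSet[w] b})
      = m ⊔ w := by
  refine le_antisymm (MeasurableSpace.generateFrom_le ?_) (sup_le ?_ ?_)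
  · rintro _ ⟨a, ha, b, hb, rfl⟩
    exact MeasurableSet.inter ((le_sup_left : m ≤ m ⊔ w) _ ha) ((le_sup_right : w ≤ m ⊔ w) _ hb)
  · exact fun a ha => MeasurableSpace.measurableSet_generateFrom
      ⟨a, ha, univ, @MeasurableSet.univ _ w, inter_univ a⟩
  · exact fun b hb => MeasurableSpace.measurableSet_generateFrom
      ⟨univ, @MeasurableSet.univ _ m, b, hb, univ_inter b⟩

theorem isPiSystem_image2_inter_measurableSet {Ω : Type*} (m w : MeasurableSpace Ω) :
    IsPiSystem (image2 (· ∩ ·) {a : Set Ω | MeasurableSet[m] a} {b | MeasurableSet[w] b}) := by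
  rintro _ ⟨a, ha, b, hb, rfl⟩ _ ⟨a', ha', b', hb', rfl⟩ -
  exact ⟨a ∩ a', MeasurableSet.inter ha ha', b ∩ b', MeasurableSet.inter hb hb',
    inter_inter_inter_comm a a' b b'⟩

/-- The integral over the intersection of two events factorizes if one of them is independent of
the other one and of the integrand. -/
theorem ProbabilityTheory.Indep.setIntegral_inter {Ω : Type*} {m w mΩ : MeasurableSpace Ω}
    {μ : Measure Ω} [IsProbabilityMeasure μ] (h : Indep w m μ) (hm : m ≤ mΩ) (hw : w ≤ mΩ)
    {f : Ω → ℝ} (hf : StronglyMeasurable[m] f) {a b : Set Ω} (ha : MeasurableSet[m] a)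
    (hb : MeasurableSet[w] b) : ∫ ω in a ∩ b, f ω ∂μ = μ.real b * ∫ ω in a, f ω ∂μ := by
  have hX : Measurable[w] (b.indicator fun _ => (1 : ℝ)) := measurable_const.indicator hb
  have hY : StronglyMeasurable[m] (a.indicator f) := hf.indicator ha
  have hind : IndepFun (b.indicator fun _ => (1 : ℝ)) (a.indicator f) μ :=
    indep_of_indep_of_le_left (indep_of_indep_of_le_right h hY.measurable.comap_le) hX.comap_le
  have hmul := hind.integral_fun_mul_eq_mul_integral
    (hX.mono hw le_rfl).aestronglyMeasurable (hY.mono hm).aestronglyMeasurable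
  rw [integral_indicator (hw _ hb), integral_indicator (hm _ ha), setIntegral_const, smul_eq_mul,
    mul_one] at hmul
  rw [← hmul, ← integral_indicator ((hm _ ha).inter (hw _ hb))]
  congr 1
  funext ω
  by_cases h1 : ω ∈ a <;> by_cases h2 : ω ∈ b <;> simp [h1, h2]

/-- Enlarging the conditioning σ-algebra by an independent one does not change the conditional
expectation. -/
theorem MeasureTheory.condExp_sup_of_indep {Ω : Type*} {m m' w mΩ : MeasurableSpace Ω}
    {μ : Measure Ω} [IsProbabilityMeasure μ] (hm : m ≤ m') (hm' : m' ≤ mΩ) (hw : w ≤ mΩ)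
    (h : Indep w m' μ) {f : Ω → ℝ} (hf : StronglyMeasurable[m'] f) (hfi : Integrable f μ) :
    μ[f | m ⊔ w] =ᵐ[μ] μ[f | m] := by
  have hsup : m ⊔ w ≤ mΩ := sup_le (hm.trans hm') hw
  have hce : Integrable (μ[f | m]) μ := integrable_condExp
  refine (ae_eq_condExp_of_forall_setIntegral_eq hsup hfi (fun s _ _ => hce.integrableOn) ?_
    ((stronglyMeasurable_condExp (m := m)).mono
      (le_sup_left : m ≤ m ⊔ w)).aestronglyMeasurable).symm
  intro B hB _
  induction B, hB using MeasurableSpace.induction_on_inter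
    (MeasurableSpace.generateFrom_inter_eq_sup m w).symm
    (isPiSystem_image2_inter_measurableSet m w) with
  | empty => simp
  | basic s hs =>
    obtain ⟨a, ha, b, hb, rfl⟩ := hs
    have hae : MeasurableSet[m] a := ha
    simp only
    -- On an intersection a ∩ b, both integrals carry the same factor μ(b), and what remains is the
    -- defining property on a.
    rw [h.setIntegral_inter hm' hw hf (hm _ ha) hb,
      h.setIntegral_inter hm' hw (stronglyMeasurable_condExp.mono hm) (hm _ ha) hb,
      setIntegral_condExp (hm.trans hm') hfi hae]
  | compl s hs ih =>
    have h1 := integral_add_compl (hsup _ hs) hce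
    have h2 := integral_add_compl (hsup _ hs) hfi
    rw [integral_condExp (hm.trans hm')] at h1
    have := ih (measure_lt_top _ _)
    linarith
  | iUnion s hd hs ih =>
    rw [integral_iUnion (fun i => hsup _ (hs i)) hd hce.integrableOn,
      integral_iUnion (fun i => hsup _ (hs i)) hd hfi.integrableOn]
    exact tsum_congr fun i => ih i (measure_lt_top _ _)

/-- If, on the event `A`, the variable `S` has the survival function `F` conditionally on `m`, then
a random variable `R` measurable with respect to `m` can be substituted for the time variable. -/
theorem MeasureTheory.setIntegral_mul_indicator_lt {Ω : Type*} {m mΩ : MeasurableSpace Ω}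
    {μ : Measure Ω} [IsProbabilityMeasure μ] (hm : m ≤ mΩ) {S R : Ω → ℝ≥0} (hS : Measurable S)
    (hR : Measurable[m] R) {A : Set Ω} (hA : MeasurableSet A) {F : ℝ≥0 → ℝ}
    (hF : ∀ B, MeasurableSet[m] B → ∀ t,
      μ.real (A ∩ (B ∩ {ω | t < S ω})) = F t * μ.real (A ∩ B))
    {h : Ω → ℝ} (hh : Measurable[m] h) (hhi : Integrable h μ) :
    ∫ ω in A, h ω * {ω | R ω < S ω}.indicator (fun _ => 1) ω ∂μ = ∫ ω in A, h ω * F (R ω) ∂μ := by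
  rcases eq_or_ne (μ A) 0 with hA0 | hA0
  · rw [Measure.restrict_eq_zero.2 hA0, integral_zero_measure, integral_zero_measure]
  have : IsProbabilityMeasure (μ[|A]) := cond_isProbabilityMeasure hA0
  have hA0' : μ.real A ≠ 0 := by simpa [measureReal_eq_zero_iff] using hA0
  have hcond : ∀ B, (μ[|A]).real B = (μ.real A)⁻¹ * μ.real (A ∩ B) := fun B => by
    simp [measureReal_def, cond_apply hA]
  have hsurv : ∀ t, (μ[|A]).real {ω | t < S ω} = F t := fun t => by
    have := hF univ (@MeasurableSet.univ _ m) t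
    rw [univ_inter, inter_univ] at this
    rw [hcond, this, mul_comm (F t), inv_mul_cancel_left₀ hA0']
  -- The survival function F does not depend on ω, so under the measure conditioned on A the
  -- variable S is independent of m. Fubini then integrates S out with R frozen.
  have hind : Indep m (MeasurableSpace.comap S inferInstance) (μ[|A]) := by
    refine IndepSets.indep hm hS.comap_le (@MeasurableSpace.isPiSystem_measurableSet _ m)
      (isPiSystem_Ioi.comap S) (@MeasurableSpace.generateFrom_measurableSet _ m).symm ?_ ?_
    · rw [BorelSpace.measurable_eq (α := ℝ≥0), borel_eq_generateFrom_Ioi,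
        MeasurableSpace.comap_generateFrom]
      rfl
    · rw [IndepSets_iff]
      rintro B _ hB ⟨_, ⟨t, rfl⟩, rfl⟩
      have h1 : (μ[|A]).real (B ∩ {ω | t < S ω})
          = (μ[|A]).real B * (μ[|A]).real {ω | t < S ω} := by
        rw [hsurv, hcond, hcond, hF B hB]
        ring
      rw [← ENNReal.toReal_eq_toReal_iff' (measure_ne_top _ _)
        (ENNReal.mul_ne_top (measure_ne_top _ _) (measure_ne_top _ _)), ENNReal.toReal_mul]
      exact h1
  have hpair : Measurable[m] fun ω => (h ω, R ω) := hh.prodMk hR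
  have hpair' : Measurable fun ω => (h ω, R ω) := hpair.mono hm le_rfl
  have hindf : IndepFun (fun ω => (h ω, R ω)) S (μ[|A]) :=
    indep_of_indep_of_le_left hind hpair.comap_le
  have hmap := (indepFun_iff_map_prod_eq_prod_map_map hpair'.aemeasurable hS.aemeasurable).1 hindf
  have hG : Measurable fun p : (ℝ × ℝ≥0) × ℝ≥0 =>
      p.1.1 * {p : (ℝ × ℝ≥0) × ℝ≥0 | p.1.2 < p.2}.indicator (fun _ => (1 : ℝ)) p :=
    (measurable_fst.comp measurable_fst).mul (measurable_const.indicator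
      (measurableSet_lt (measurable_snd.comp measurable_fst) measurable_snd))
  have htriple : Measurable fun ω => ((h ω, R ω), S ω) := hpair'.prodMk hS
  have hhi' : Integrable h (μ[|A]) := hhi.restrict.smul_measure (ENNReal.inv_ne_top.2 hA0)
  have hGi : Integrable (fun p : (ℝ × ℝ≥0) × ℝ≥0 =>
      p.1.1 * {p : (ℝ × ℝ≥0) × ℝ≥0 | p.1.2 < p.2}.indicator (fun _ => (1 : ℝ)) p)
      (((μ[|A]).map fun ω => (h ω, R ω)).prod ((μ[|A]).map S)) := by
    rw [← hmap, integrable_map_measure hG.aestronglyMeasurable htriple.aemeasurable]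
    refine hhi'.mono (hG.comp htriple).aestronglyMeasurable (Filter.Eventually.of_forall fun ω => ?_)
    by_cases hlt : R ω < S ω <;> simp [hlt]
  have key : ∫ ω, h ω * {ω | R ω < S ω}.indicator (fun _ => 1) ω ∂(μ[|A])
      = ∫ ω, h ω * F (R ω) ∂(μ[|A]) := by
    have h1 := integral_map htriple.aemeasurable (μ := μ[|A]) hG.aestronglyMeasurable
    rw [hmap, integral_prod _ hGi] at h1
    have hinner : ∀ x : ℝ × ℝ≥0, ∫ s, x.1 * {p : (ℝ × ℝ≥0) × ℝ≥0 | p.1.2 < p.2}.indicator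
        (fun _ => (1 : ℝ)) (x, s) ∂((μ[|A]).map S) = x.1 * F x.2 := by
      intro x
      rw [integral_const_mul, ← hsurv]
      have : (fun s : ℝ≥0 => {p : (ℝ × ℝ≥0) × ℝ≥0 | p.1.2 < p.2}.indicator
          (fun _ => (1 : ℝ)) (x, s)) = (Ioi x.2).indicator fun _ => 1 := by
        funext s
        simp [indicator]
      rw [this, integral_indicator measurableSet_Ioi, setIntegral_const, smul_eq_mul, mul_one,
        map_measureReal_apply hS measurableSet_Ioi]
      rfl
    simp only [hinner] at h1
    have hanti : Antitone F := fun s t hst => by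
      rw [← hsurv, ← hsurv]
      exact measureReal_mono fun ω hω => lt_of_le_of_lt hst hω
    have hFm : Measurable fun x : ℝ × ℝ≥0 => x.1 * F x.2 :=
      measurable_fst.mul (hanti.measurable.comp measurable_snd)
    rw [integral_map hpair'.aemeasurable hFm.aestronglyMeasurable] at h1
    rw [h1]
    rfl
  rw [ProbabilityTheory.cond, integral_smul_measure, integral_smul_measure] at key
  have hne : (μ A)⁻¹.toReal ≠ 0 := by
    rw [ENNReal.toReal_inv]
    exact inv_ne_zero hA0'
  exact smul_right_injective ℝ hne key

/-! ### The law of the next inter-jump time given the observations -/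

namespace ObservedPDMP.Realization

variable {d q : ℕ} {M : ObservedPDMP d q} {π : Fin q → ℝ} {Ω : Type*} {mΩ : MeasurableSpace Ω}
  {μ : Measure Ω} (P : M.Realization π μ)

/-- The σ-algebra generated by the past of the chain and by the whole noise sequence. -/
@[reducible] def noisyPast (n : ℕ) : MeasurableSpace Ω :=
  chainPast P.Z P.S n ⊔ MeasurableSpace.comap (fun ω (k : ℕ) => P.W (k + 1) ω) inferInstance

theorem measurable_noise : Measurable fun ω (k : ℕ) => P.W (k + 1) ω :=
  measurable_pi_lambda _ fun k => P.measurable_W (k + 1)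

theorem noisyPast_le (n : ℕ) : P.noisyPast n ≤ mΩ :=
  sup_le (P.chainPast_le n) P.measurable_noise.comap_le

theorem observedPast_le_noisyPast (n : ℕ) : P.observedPast n ≤ P.noisyPast n := by
  refine iSup₂_le fun j hj => sup_le (Measurable.comap_le ?_) (Measurable.comap_le ?_)
  · refine Finset.measurable_fun_sum _ fun k hk => ?_
    have hk' : k + 1 ≤ n := (Nat.succ_le_of_lt (Finset.mem_range.1 hk)).trans hj
    exact (P.measurable_S_chainPast hk').mono le_sup_left le_rfl
  · cases j with
    | zero => exact measurable_const
    | succ j =>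
      have h1 : Measurable[P.noisyPast n] (P.Z (j + 1)) :=
        (P.measurable_Z_chainPast hj).mono le_sup_left le_rfl
      have h2 : Measurable[P.noisyPast n] (P.W (j + 1)) :=
        ((measurable_pi_apply j).comp (comap_measurable
          (fun ω (k : ℕ) => P.W (k + 1) ω))).mono le_sup_right le_rfl
      exact (M.measurable_obs.comp h1).add h2

variable [IsProbabilityMeasure μ]

/-- The noise brings no information on the next inter-jump time. -/
theorem condExp_lt_S_noisyPast (n : ℕ) (t : ℝ≥0) :
    μ[{ω | t < P.S (n + 1) ω}.indicator (fun _ => (1 : ℝ)) | P.noisyPast n]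
      =ᵐ[μ] fun ω => M.survival (P.Z n ω) t := by
  have hZS : Measurable fun ω (k : ℕ) => (P.Z k ω, P.S k ω) :=
    measurable_pi_lambda _ fun k => (P.measurable_Z k).prodMk (P.measurable_S k)
  -- The σ-algebra of the whole chain: it contains the event on S_{n+1} and is still independent of
  -- the noise.
  let m' : MeasurableSpace Ω := MeasurableSpace.comap (fun ω (k : ℕ) => (P.Z k ω, P.S k ω))
    inferInstance
  have hm' : m' ≤ mΩ := hZS.comap_le
  have hpair : ∀ k, Measurable[m'] fun ω => (P.Z k ω, P.S k ω) := fun k =>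
    (measurable_pi_apply k).comp (comap_measurable (fun ω (k : ℕ) => (P.Z k ω, P.S k ω)))
  have hle : chainPast P.Z P.S n ≤ m' :=
    (measurable_pi_lambda _ fun k : Fin (n + 1) => hpair k).comap_le
  have hS : MeasurableSet[m'] {ω | t < P.S (n + 1) ω} :=
    (measurable_snd.comp (hpair (n + 1))) measurableSet_Ioi
  refine (condExp_sup_of_indep hle hm' P.measurable_noise.comap_le P.indepFun_W
    (stronglyMeasurable_const.indicator hS) ?_).trans (P.law_S n t)
  exact (integrable_const _).indicator (hm' _ hS)

variable (hπ : π ∈ stdSimplex ℝ (Fin q))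

include hπ in
/-- On `{Z_n = x}`, the survival function of `S_{n+1}` given the observations up to `T_n` is that of
the next jump from `x`. -/
theorem measureReal_inter_lt_S_filtrationT (n : ℕ) (x : EuclideanSpace ℝ (Fin d)) (t : ℝ≥0)
    {B : Set Ω} (hB : MeasurableSet[P.filtrationT n] B) :
    μ.real ({ω | P.Z n ω = x} ∩ (B ∩ {ω | t < P.S (n + 1) ω}))
      = M.survival x t * μ.real ({ω | P.Z n ω = x} ∩ B) := by
  obtain ⟨B', hB', hBB'⟩ := P.filtrationT_le_eventuallyMeasurableSpace hπ n B hB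
  have hB'm : MeasurableSet[P.noisyPast n] B' := P.observedPast_le_noisyPast n _ hB'
  have hA : MeasurableSet[P.noisyPast n] {ω | P.Z n ω = x} :=
    (le_sup_left : chainPast P.Z P.S n ≤ P.noisyPast n) _
      (P.measurable_Z_chainPast le_rfl (measurableSet_singleton x))
  have hAB : MeasurableSet[P.noisyPast n] ({ω | P.Z n ω = x} ∩ B') := hA.inter hB'm
  have hS := P.measurableSet_lt_S (n + 1) t
  have hint : Integrable ({ω | t < P.S (n + 1) ω}.indicator fun _ => (1 : ℝ)) μ :=
    (integrable_const _).indicator hS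
  have h1 := setIntegral_condExp (P.noisyPast_le n) hint hAB
  rw [setIntegral_congr_ae (P.noisyPast_le n _ hAB)
      ((P.condExp_lt_S_noisyPast n t).mono fun ω h _ => h),
    setIntegral_congr_fun (g := fun _ => M.survival x t) (P.noisyPast_le n _ hAB)
      (fun ω hω => by
        have : P.Z n ω = x := hω.1
        simp only [this]), integral_indicator hS, setIntegral_const, setIntegral_const,
    measureReal_restrict_apply hS, smul_eq_mul, smul_eq_mul, mul_one] at h1
  rw [Filter.eventuallyEq_set] at hBB'
  have e1 : ({ω | P.Z n ω = x} ∩ (B ∩ {ω | t < P.S (n + 1) ω}) : Set Ω)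
      =ᵐ[μ] ({ω | t < P.S (n + 1) ω} ∩ ({ω | P.Z n ω = x} ∩ B') : Set Ω) := by
    rw [Filter.eventuallyEq_set]
    filter_upwards [hBB'] with ω hω
    simp only [mem_inter_iff, hω]
    tauto
  have e2 : ({ω | P.Z n ω = x} ∩ B : Set Ω) =ᵐ[μ] ({ω | P.Z n ω = x} ∩ B' : Set Ω) := by
    rw [Filter.eventuallyEq_set]
    filter_upwards [hBB'] with ω hω
    simp only [mem_inter_iff, hω]
  rw [measureReal_congr e1, measureReal_congr e2, mul_comm, h1]

end ObservedPDMP.Realization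

/-- A bounded measurable multiplier is transferred through a conditional expectation. -/
theorem MeasureTheory.integral_mul_condExp_indicator_one {Ω : Type*} {m mΩ : MeasurableSpace Ω}
    {μ : Measure Ω} [IsProbabilityMeasure μ] (hm : m ≤ mΩ) {A : Set Ω} (hA : MeasurableSet A)
    {H : Ω → ℝ} (hH : Measurable[m] H) {C : ℝ} (hC : ∀ ω, |H ω| ≤ C) :
    Integrable (fun ω => H ω * (μ[A.indicator (fun _ => (1 : ℝ)) | m]) ω) μ ∧
      ∫ ω, H ω * (μ[A.indicator (fun _ => (1 : ℝ)) | m]) ω ∂μ = ∫ ω in A, H ω ∂μ := by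
  have hHm : StronglyMeasurable[m] H := hH.stronglyMeasurable
  have hint : Integrable (A.indicator fun _ => (1 : ℝ)) μ := (integrable_const _).indicator hA
  have hprod : Integrable (H * A.indicator fun _ => (1 : ℝ)) μ :=
    hint.bdd_mul (hHm.mono hm).aestronglyMeasurable (Filter.Eventually.of_forall hC)
  have hpull := condExp_mul_of_stronglyMeasurable_left hHm hprod hint
  refine ⟨integrable_condExp.congr hpull, ?_⟩
  have h1 : ∫ ω, H ω * (μ[A.indicator (fun _ => (1 : ℝ)) | m]) ω ∂μ
      = ∫ ω, (μ[H * A.indicator (fun _ => (1 : ℝ)) | m]) ω ∂μ :=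
    integral_congr_ae hpull.symm
  rw [h1, integral_condExp hm, ← integral_indicator hA]
  refine integral_congr_ae (Filter.Eventually.of_forall fun ω => ?_)
  by_cases hω : ω ∈ A <;> simp [hω]

theorem ProbabilityTheory.cond_eq_self_of_ae {Ω : Type*} {mΩ : MeasurableSpace Ω} {μ : Measure Ω}
    [IsProbabilityMeasure μ] {s : Set Ω} (h : ∀ᵐ ω ∂μ, ω ∈ s) : μ[|s] = μ := by
  have hs : μ s = 1 := by
    rw [measure_congr (Filter.eventuallyEq_univ.2 (show s ∈ ae μ from h)), measure_univ]
  rw [ProbabilityTheory.cond, hs, inv_one, one_smul, Measure.restrict_eq_self_of_ae_mem h]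

/-! ### Pathwise decomposition, initial filter and existence of R_k -/

namespace ObservedPDMP.Realization

variable {d q : ℕ} {M : ObservedPDMP d q} {π : Fin q → ℝ} {Ω : Type*} {mΩ : MeasurableSpace Ω}
  {μ : Measure Ω} (P : M.Realization π μ) {σ : Ω → WithTop ℝ≥0}

theorem observedPast_zero : P.observedPast 0 = ⊥ := by
  rw [eq_bot_iff]
  refine iSup₂_le fun j hj => ?_
  obtain rfl : j = 0 := Nat.le_zero.1 hj
  have hT : P.T 0 = fun _ => 0 := funext P.T_zero
  have hY : P.Yobs 0 = fun _ => M.y0 := funext fun ω => if_pos rfl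
  rw [hT, hY, MeasurableSpace.comap_const, MeasurableSpace.comap_const, sup_bot_eq]

section Decomposition

theorem stoppedState_eq {n : ℕ} {ω : Ω} {a : ℝ≥0}
    (h : min (σ ω) ((P.T n ω : ℝ≥0) : WithTop ℝ≥0) = a) : P.stoppedState σ n ω = P.X a ω := by
  rw [stoppedState, stoppedValue, h]
  rfl

theorem X_T {n : ℕ} {ω : Ω} (hT : ∀ n, P.T n ω < P.T (n + 1) ω) :
    P.X (P.T n ω) ω = P.Z n ω := by
  rw [P.X_eq le_rfl (hT n), tsub_self, M.flow_zero]

open Classical in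
/-- Before `T_n`, the stopped process is either frozen between two jumps or has reached `Z_n`. -/
theorem apply_stoppedState_eq_sum {R : ℕ → Ω → ℝ≥0} {ω : Ω} (g : EuclideanSpace ℝ (Fin d) → ℝ)
    (hT : ∀ n, P.T n ω < P.T (n + 1) ω)
    (hR : ∀ n, ((P.T n ω : ℝ≥0) : WithTop ℝ≥0) ≤ σ ω →
      min (σ ω) ((P.T (n + 1) ω : ℝ≥0) : WithTop ℝ≥0)
        = ((min (P.T n ω + R n ω) (P.T (n + 1) ω) : ℝ≥0) : WithTop ℝ≥0)) (n : ℕ) :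
    g (P.stoppedState σ n ω) =
      ∑ k ∈ Finset.range n,
        (if ((P.T k ω : ℝ≥0) : WithTop ℝ≥0) ≤ σ ω ∧ R k ω < P.S (k + 1) ω then
          g (M.flow (P.Z k ω) (R k ω)) else 0)
      + if ((P.T n ω : ℝ≥0) : WithTop ℝ≥0) ≤ σ ω then g (P.Z n ω) else 0 := by
  induction n with
  | zero =>
    have h0 : ((P.T 0 ω : ℝ≥0) : WithTop ℝ≥0) ≤ σ ω := by simp [P.T_zero]
    rw [P.stoppedState_eq (min_eq_right h0), P.X_T hT, Finset.sum_range_zero, zero_add, if_pos h0]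
  | succ n ih =>
    rw [Finset.sum_range_succ]
    by_cases hn : ((P.T n ω : ℝ≥0) : WithTop ℝ≥0) ≤ σ ω
    -- When T_n ≤ σ, the induction hypothesis reads g(Z_n) = sum + g(Z_n), so all earlier terms
    -- cancel.
    · rw [P.stoppedState_eq (min_eq_right hn), P.X_T hT, if_pos hn, eq_comm, add_eq_right] at ih
      rw [ih, zero_add]
      have hmin := hR n hn
      rcases lt_or_ge (R n ω) (P.S (n + 1) ω) with hlt | hge
      · have hlt' : P.T n ω + R n ω < P.T (n + 1) ω := by
          rw [P.T_succ]
          gcongr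
        rw [min_eq_left hlt'.le] at hmin
        have hσ : ¬ ((P.T (n + 1) ω : ℝ≥0) : WithTop ℝ≥0) ≤ σ ω := by
          intro h
          rw [min_eq_right h, WithTop.coe_inj] at hmin
          exact hlt'.ne' hmin
        rw [P.stoppedState_eq hmin, P.X_eq le_self_add hlt', add_tsub_cancel_left,
          if_pos ⟨hn, hlt⟩, if_neg hσ, add_zero]
      · have hge' : P.T (n + 1) ω ≤ P.T n ω + R n ω := by
          rw [P.T_succ]
          gcongr
        rw [min_eq_right hge'] at hmin
        rw [P.stoppedState_eq hmin, P.X_T hT,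
          if_neg fun h => absurd h.2 (not_lt.2 hge), if_pos (min_eq_right_iff.1 hmin), zero_add]
    · have hlt := not_le.1 hn
      have hle : ((P.T n ω : ℝ≥0) : WithTop ℝ≥0) ≤ P.T (n + 1) ω :=
        WithTop.coe_le_coe.2 (hT n).le
      have hn' : ¬ ((P.T (n + 1) ω : ℝ≥0) : WithTop ℝ≥0) ≤ σ ω := fun h => hn (hle.trans h)
      have hstate : P.stoppedState σ (n + 1) ω = P.stoppedState σ n ω := by
        rw [stoppedState, stoppedState, stoppedValue, stoppedValue, min_eq_left hlt.le,
          min_eq_left (hlt.le.trans hle)]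
      rw [hstate, ih, if_neg hn, if_neg hn', if_neg fun h => hn h.1, add_zero, add_zero]

end Decomposition

variable [IsProbabilityMeasure μ] (hπ : π ∈ stdSimplex ℝ (Fin q))

include hπ in
theorem filter_zero_ae_eq (i : Fin q) : P.filter 0 i =ᵐ[μ] fun _ => π i := by
  have hA := P.measurableSet_Z_eq 0 (M.pt i)
  have hint : Integrable ({ω | P.Z 0 ω = M.pt i}.indicator fun _ => (1 : ℝ)) μ :=
    (integrable_const _).indicator hA
  refine (ae_eq_condExp_of_forall_setIntegral_eq (P.filtrationT_le hπ 0) hint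
    (fun s _ _ => (integrable_const _).integrableOn) ?_
    stronglyMeasurable_const.aestronglyMeasurable).symm
  intro s hs _
  obtain ⟨B, hB, hsB⟩ := P.filtrationT_le_eventuallyMeasurableSpace hπ 0 s hs
  rw [P.observedPast_zero, MeasurableSpace.measurableSet_bot_iff] at hB
  rw [setIntegral_congr_set hsB, setIntegral_congr_set hsB]
  rcases hB with rfl | rfl
  · simp
  · rw [setIntegral_univ, setIntegral_univ, integral_indicator hA, setIntegral_const,
      P.law_Z_zero]
    simp

include hπ in
theorem ae_mem_filterZeroEq : ∀ᵐ ω ∂μ, ω ∈ P.filterZeroEq π :=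
  ae_all_iff.2 fun i => P.filter_zero_ae_eq hπ i

include hπ in
/-- Between two jumps, a stopping time of the observed filtration is determined by the
observations up to the first of them. -/
theorem exists_isAssociated (hσ : IsStoppingTime P.filtration σ) :
    ∃ R : ℕ → Ω → ℝ≥0, P.IsAssociated σ R := by
  suffices ∀ k, ∃ R : Ω → ℝ≥0, Measurable[P.filtrationT k] R ∧
      ∀ᵐ ω ∂μ, ((P.T k ω : ℝ≥0) : WithTop ℝ≥0) ≤ σ ω →
        min (σ ω) ((P.T (k + 1) ω : ℝ≥0) : WithTop ℝ≥0)
          = ((min (P.T k ω + R ω) (P.T (k + 1) ω) : ℝ≥0) : WithTop ℝ≥0) by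
    choose R hR using this
    exact ⟨R, hR⟩
  intro k
  have hB : ∀ t : ℝ≥0, ∃ B, MeasurableSet[P.observedPast k] B ∧
      ∀ᵐ ω ∂μ, P.T k ω ≤ t ∧ t < P.T (k + 1) ω → (σ ω ≤ t ↔ ω ∈ B) := by
    intro t
    obtain ⟨B, hB, hσB⟩ := P.filtration_le_eventuallyMeasurableSpace k t _ (hσ t)
    rw [Filter.eventuallyEq_set, ae_restrict_iff' (P.measurableSet_T_le_lt k t)] at hσB
    exact ⟨B, hB, hσB⟩
  choose B hBm hB using hB
  let D : ℕ → ℝ≥0 := TopologicalSpace.denseSeq ℝ≥0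
  let V : ℕ → Set Ω := fun m => {ω | P.T k ω ≤ D m} ∩ B (D m)
  have hV : ∀ m, MeasurableSet[P.observedPast k] (V m) := fun m =>
    MeasurableSet.inter (P.measurable_T_observedPast le_rfl measurableSet_Iic) (hBm _)
  -- A common bound of the exit times, hence of S_{k+1}: truncating at τ keeps R_k finite when ρ = ∞
  -- without affecting anything before T_{k+1}.
  obtain ⟨τ, hτ⟩ : ∃ τ : ℝ≥0, ∀ i, M.exitTime (M.pt i) ≤ τ := by
    refine ⟨(∑ i, M.exitTime (M.pt i)).toNNReal, fun i => ?_⟩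
    rw [ENNReal.coe_toNNReal (ENNReal.sum_ne_top.2 fun i _ => (M.exitTime_lt_top i).ne)]
    exact Finset.single_le_sum (f := fun i => M.exitTime (M.pt i)) (fun _ _ => zero_le)
      (Finset.mem_univ i)
  classical
  -- The first time after T_k at which the observed past up to T_k declares σ to have occurred. It
  -- equals σ if T_k ≤ σ < T_{k+1}, and is at least T_{k+1} if σ is.
  let ρ : Ω → ℝ≥0∞ := fun ω => ⨅ m, if ω ∈ V m then (D m : ℝ≥0∞) else ⊤
  have hρ : Measurable[P.observedPast k] ρ :=
    Measurable.iInf fun m => Measurable.ite (hV m) measurable_const measurable_const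
  refine ⟨fun ω => (min (ρ ω - P.T k ω) τ).toNNReal, ?_, ?_⟩
  · have : Measurable[P.observedPast k] fun ω => (min (ρ ω - P.T k ω) τ).toNNReal :=
      ((hρ.sub (P.measurable_T_observedPast le_rfl).coe_nnreal_ennreal).min
        measurable_const).ennreal_toNNReal
    exact this.mono (P.observedPast_le_filtrationT hπ k) le_rfl
  · filter_upwards [P.ae_T_lt_T_succ hπ, P.ae_Z_mem hπ k, P.ae_S_le_exitTime hπ k,
      ae_all_iff.2 fun m => hB (D m)] with ω hT hZ hS hω hle
    have hSτ : P.S (k + 1) ω ≤ τ := by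
      obtain ⟨i, hi⟩ := hZ
      rw [← hi] at hS
      exact_mod_cast hS.trans (hτ i)
    have hV' : ∀ m, D m < P.T (k + 1) ω → (ω ∈ V m ↔ P.T k ω ≤ D m ∧ σ ω ≤ D m) := by
      intro m hm
      simp only [V, mem_inter_iff, mem_ofPred_eq]
      exact and_congr_right fun h => (hω m ⟨h, hm⟩).symm
    have hρge : ∀ a : ℝ≥0, a ≤ P.T (k + 1) ω → (a : WithTop ℝ≥0) ≤ σ ω → (a : ℝ≥0∞) ≤ ρ ω := by
      intro a ha haσ
      refine le_iInf fun m => ?_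
      split_ifs with h
      · rcases lt_or_ge (D m) (P.T (k + 1) ω) with hm | hm
        · exact ENNReal.coe_le_coe.2
            (WithTop.coe_le_coe.1 (haσ.trans ((hV' m hm).1 h).2))
        · exact ENNReal.coe_le_coe.2 (ha.trans hm)
      · exact le_top
    rcases le_or_gt ((P.T (k + 1) ω : ℝ≥0) : WithTop ℝ≥0) (σ ω) with hcase | hcase
    · have h1 : ((P.S (k + 1) ω : ℝ≥0) : ℝ≥0∞) ≤ min (ρ ω - P.T k ω) τ := by
        refine le_min (ENNReal.le_sub_of_add_le_left ENNReal.coe_ne_top ?_)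
          (by exact_mod_cast hSτ)
        rw [← ENNReal.coe_add, ← P.T_succ]
        exact hρge _ le_rfl hcase
      have h2 : P.S (k + 1) ω ≤ (min (ρ ω - P.T k ω) τ).toNNReal :=
        ENNReal.le_toNNReal_of_coe_le h1 (ne_top_of_le_ne_top ENNReal.coe_ne_top (min_le_right _ _))
      rw [min_eq_right hcase, min_eq_right]
      rw [P.T_succ]
      gcongr
    · obtain ⟨s, hs⟩ := WithTop.ne_top_iff_exists.1 (ne_top_of_lt hcase)
      rw [← hs] at hcase hle hρge hV' ⊢
      rw [WithTop.coe_lt_coe] at hcase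
      rw [WithTop.coe_le_coe] at hle
      have hρs : ρ ω = s := by
        refine le_antisymm ?_ (hρge s hcase.le le_rfl)
        -- A dense time strictly between σ and min(ρ, T_{k+1}) would already belong to the family
        -- defining ρ.
        by_contra h
        obtain ⟨b, hb1, hb2⟩ := ENNReal.lt_iff_exists_nnreal_btwn.1 (not_le.1 h)
        obtain ⟨_, ⟨m, rfl⟩, hm1, hm2⟩ := (TopologicalSpace.denseRange_denseSeq ℝ≥0).exists_between
          (lt_min (ENNReal.coe_lt_coe.1 hb1) hcase)
        have hmV : ω ∈ V m := (hV' m (hm2.trans_le (min_le_right _ _))).2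
          ⟨hle.trans hm1.le, WithTop.coe_le_coe.2 hm1.le⟩
        have : ρ ω ≤ D m := (iInf_le _ m).trans (by rw [if_pos hmV])
        exact absurd (hb2.trans_le this)
          (not_lt.2 (ENNReal.coe_le_coe.2 (hm2.le.trans (min_le_left _ _))))
      have hsub : s - P.T k ω ≤ τ := by
        refine le_trans ?_ hSτ
        rw [tsub_le_iff_left, ← P.T_succ]
        exact hcase.le
      have hR : (min (ρ ω - P.T k ω) τ).toNNReal = s - P.T k ω := by
        rw [hρs, ← ENNReal.coe_sub, min_eq_left (ENNReal.coe_le_coe.2 hsub), ENNReal.toNNReal_coe]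
      rw [hR, add_tsub_cancel_of_le hle, min_eq_left hcase.le,
        min_eq_left (WithTop.coe_le_coe.2 hcase.le)]

end ObservedPDMP.Realization

/-! ### Expectations of the running and terminal terms -/

namespace ObservedPDMP.Realization

variable {d q : ℕ} {M : ObservedPDMP d q} {π : Fin q → ℝ} {Ω : Type*} {mΩ : MeasurableSpace Ω}
  {μ : Measure Ω} (P : M.Realization π μ) {σ : Ω → WithTop ℝ≥0}

/-- The variable `1_{T_k ≤ σ} g(Φ(x_i, R_k))`, with `g` extended by zero outside the closure of the
state space. -/
def stateBeforeJump (g : EuclideanSpace ℝ (Fin d) → ℝ) (σ : Ω → WithTop ℝ≥0) (R : ℕ → Ω → ℝ≥0)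
    (k : ℕ) (i : Fin q) : Ω → ℝ :=
  {ω | ((P.T k ω : ℝ≥0) : WithTop ℝ≥0) ≤ σ ω}.indicator
    fun ω => (closure M.E).indicator g (M.flow (M.pt i) (R k ω))

/-- The survival function absorbs the constraint R_k < t^*_i, under which the flow stays in E; so g
may be extended by zero, which makes it measurable on the whole space. -/
theorem runningTerm_eq (g : EuclideanSpace ℝ (Fin d) → ℝ) (R : ℕ → Ω → ℝ≥0) (k : ℕ)
    (i : Fin q) : P.runningTerm g σ R k i = fun ω =>
      P.stateBeforeJump g σ R k i ω * M.survival (M.pt i) (R k ω) * P.filter k i ω := by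
  funext ω
  by_cases h1 : ω ∈ {ω | ((P.T k ω : ℝ≥0) : WithTop ℝ≥0) ≤ σ ω}
  · by_cases h2 : ω ∈ {ω | (R k ω : ℝ≥0∞) < M.exitTime (M.pt i)}
    · have hmem := subset_closure (PDMP.flow_mem_of_lt_exitTime (M.pt_mem i) h2)
      rw [runningTerm, stateBeforeJump, indicator_of_mem (mem_inter h1 h2), indicator_of_mem h1,
        indicator_of_mem hmem, PDMP.survival,
        if_pos (mem_ofPred.1 h2)]
    · rw [runningTerm, indicator_of_notMem fun h => h2 h.2, PDMP.survival,
        if_neg (show ¬ (R k ω : ℝ≥0∞) < M.exitTime (M.pt i) from h2), mul_zero, zero_mul]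
  · rw [runningTerm, stateBeforeJump, indicator_of_notMem fun h => h1 h.1,
      indicator_of_notMem h1, zero_mul, zero_mul]

variable [IsProbabilityMeasure μ] (hπ : π ∈ stdSimplex ℝ (Fin q))
  {g : EuclideanSpace ℝ (Fin d) → ℝ} (hg : Measurable ((closure M.E).domRestrict g))
  {C : ℝ} (hC : ∀ x ∈ closure M.E, |g x| ≤ C) {R : ℕ → Ω → ℝ≥0}

include hπ in
theorem measurableSet_T_le_stoppingTime (hσ : IsStoppingTime P.filtration σ) (k : ℕ) :
    MeasurableSet[P.filtrationT k] {ω | ((P.T k ω : ℝ≥0) : WithTop ℝ≥0) ≤ σ ω} := by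
  rw [P.filtrationT_eq hπ]
  exact IsStoppingTime.measurableSet_le_stopping_time _ hσ

include hπ hg in
theorem measurable_stateBeforeJump (hσ : IsStoppingTime P.filtration σ) {k : ℕ}
    (hR : Measurable[P.filtrationT k] (R k)) (i : Fin q) :
    Measurable[P.filtrationT k] (P.stateBeforeJump g σ R k i) := by
  have h1 : Measurable fun t => (closure M.E).indicator g (M.flow (M.pt i) t) :=
    (hg.indicator_of_domRestrict isClosed_closure.measurableSet).comp
      (M.continuous_flow_right _).measurable
  exact (h1.comp hR).indicator (P.measurableSet_T_le_stoppingTime hπ hσ k)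

include hC in
omit [IsProbabilityMeasure μ] in
theorem abs_stateBeforeJump_le (k : ℕ) (i : Fin q) (ω : Ω) :
    |P.stateBeforeJump g σ R k i ω| ≤ C := by
  have hC0 : 0 ≤ C := (abs_nonneg _).trans (hC _ (subset_closure (M.pt_mem i)))
  rw [← Real.norm_eq_abs, stateBeforeJump]
  refine (norm_indicator_le_norm_self _ ω).trans ?_
  by_cases h2 : M.flow (M.pt i) (R k ω) ∈ closure M.E
  · simpa [h2] using hC _ h2
  · simpa [h2] using hC0

include hπ hg hC in
theorem integrable_stateBeforeJump (hσ : IsStoppingTime P.filtration σ) {k : ℕ}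
    (hR : Measurable[P.filtrationT k] (R k)) (i : Fin q) :
    Integrable (P.stateBeforeJump g σ R k i) μ :=
  Integrable.of_bound ((P.measurable_stateBeforeJump hπ hg hσ hR i).mono
    (P.filtrationT_le hπ k) le_rfl).aestronglyMeasurable C
    (Filter.Eventually.of_forall (P.abs_stateBeforeJump_le hC k i))

include hπ hg hC in
-- The filter is first turned back into the indicator of {Z_k = x_i}; on that event the survival
-- function at R_k is then exchanged for the indicator of {R_k < S_{k+1}}.
theorem integral_runningTerm (hσ : IsStoppingTime P.filtration σ) {k : ℕ}
    (hR : Measurable[P.filtrationT k] (R k)) (i : Fin q) :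
    Integrable (P.runningTerm g σ R k i) μ ∧
      ∫ ω, P.runningTerm g σ R k i ω ∂μ = ∫ ω in {ω | P.Z k ω = M.pt i},
        P.stateBeforeJump g σ R k i ω * {ω | R k ω < P.S (k + 1) ω}.indicator (fun _ => 1) ω ∂μ := by
  have hu := P.measurable_stateBeforeJump hπ hg hσ hR i
  have hsurv : Measurable (M.survival (M.pt i)) :=
    (PDMP.antitone_survival M.rate_bounded (M.pt_mem i)).measurable
  have hH : Measurable[P.filtrationT k] fun ω =>
      P.stateBeforeJump g σ R k i ω * M.survival (M.pt i) (R k ω) := hu.mul (hsurv.comp hR)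
  have hbound : ∀ ω, |P.stateBeforeJump g σ R k i ω * M.survival (M.pt i) (R k ω)| ≤ C := by
    intro ω
    rw [abs_mul, abs_of_nonneg (M.survival_nonneg _ _)]
    exact (mul_le_of_le_one_right (abs_nonneg _) (PDMP.survival_le_one (M.pt_mem i) _)).trans
      (P.abs_stateBeforeJump_le hC k i ω)
  have h := integral_mul_condExp_indicator_one (μ := μ) (P.filtrationT_le hπ k)
    (P.measurableSet_Z_eq k (M.pt i)) hH hbound
  rw [P.runningTerm_eq]
  refine ⟨h.1, h.2.trans ?_⟩
  exact (setIntegral_mul_indicator_lt (P.filtrationT_le hπ k) (P.measurable_S (k + 1)) hR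
    (P.measurableSet_Z_eq k (M.pt i))
    (fun B hB t => P.measureReal_inter_lt_S_filtrationT hπ k (M.pt i) t hB) hu
    (P.integrable_stateBeforeJump hπ hg hC hσ hR i)).symm

include hπ in
theorem integral_terminalTerm (g : EuclideanSpace ℝ (Fin d) → ℝ)
    (hσ : IsStoppingTime P.filtration σ) (n : ℕ) (i : Fin q) :
    Integrable (P.terminalTerm g σ n i) μ ∧
      ∫ ω, P.terminalTerm g σ n i ω ∂μ = ∫ ω in {ω | P.Z n ω = M.pt i},
        {ω | ((P.T n ω : ℝ≥0) : WithTop ℝ≥0) ≤ σ ω}.indicator (fun _ => g (M.pt i)) ω ∂μ := by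
  have hH : Measurable[P.filtrationT n]
      ({ω | ((P.T n ω : ℝ≥0) : WithTop ℝ≥0) ≤ σ ω}.indicator fun _ => g (M.pt i)) :=
    measurable_const.indicator (P.measurableSet_T_le_stoppingTime hπ hσ n)
  have hbound : ∀ ω, |{ω | ((P.T n ω : ℝ≥0) : WithTop ℝ≥0) ≤ σ ω}.indicator
      (fun _ => g (M.pt i)) ω| ≤ |g (M.pt i)| := fun ω =>
    norm_indicator_le_norm_self (fun _ => g (M.pt i)) ω
  have h := integral_mul_condExp_indicator_one (μ := μ) (P.filtrationT_le hπ n)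
    (P.measurableSet_Z_eq n (M.pt i)) hH hbound
  have heq : P.terminalTerm g σ n i = fun ω =>
      {ω | ((P.T n ω : ℝ≥0) : WithTop ℝ≥0) ≤ σ ω}.indicator (fun _ => g (M.pt i)) ω *
        P.filter n i ω := by
    funext ω
    exact indicator_mul_left _ (fun _ => g (M.pt i)) (P.filter n i)
  rw [heq]
  exact h

include hπ in
theorem apply_stoppedState_ae_eq (g : EuclideanSpace ℝ (Fin d) → ℝ) (hR : P.IsAssociated σ R)
    (n : ℕ) :
    (fun ω => g (P.stoppedState σ n ω)) =ᵐ[μ] fun ω =>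
      ∑ k ∈ Finset.range n, ∑ i, {ω | P.Z k ω = M.pt i}.indicator (fun ω =>
        P.stateBeforeJump g σ R k i ω * {ω | R k ω < P.S (k + 1) ω}.indicator (fun _ => 1) ω) ω
      + ∑ i, {ω | P.Z n ω = M.pt i}.indicator (fun ω =>
        {ω | ((P.T n ω : ℝ≥0) : WithTop ℝ≥0) ≤ σ ω}.indicator (fun _ => g (M.pt i)) ω) ω := by
  filter_upwards [P.ae_T_lt_T_succ hπ, ae_all_iff.2 fun k => P.ae_Z_mem hπ k,
    ae_all_iff.2 fun k => P.ae_S_le_exitTime hπ k, ae_all_iff.2 fun k => (hR k).2]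
    with ω hT hZ hS hRω
  have hsum : ∀ (k : ℕ) (F : Fin q → Ω → ℝ) (i : Fin q), M.pt i = P.Z k ω →
      ∑ j, {ω | P.Z k ω = M.pt j}.indicator (F j) ω = F i ω := by
    intro k F i hi
    rw [Finset.sum_eq_single i (fun j _ hj => indicator_of_notMem (fun h => hj ?_) _)
      (fun h => absurd (Finset.mem_univ i) h)]
    · exact indicator_of_mem (s := {ω | P.Z k ω = M.pt i}) hi.symm _
    · exact M.pt_injective (hi.trans h).symm
  rw [P.apply_stoppedState_eq_sum g hT hRω]
  congr 1
  · refine Finset.sum_congr rfl fun k _ => ?_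
    obtain ⟨i, hi⟩ := hZ k
    rw [hsum k _ i hi]
    by_cases h1 : ω ∈ {ω | ((P.T k ω : ℝ≥0) : WithTop ℝ≥0) ≤ σ ω}
    · by_cases h2 : ω ∈ {ω | R k ω < P.S (k + 1) ω}
      -- R_k < S_{k+1} ≤ t^*_i keeps the flow in E, so the extension of g by zero is not seen.
      · have hlt : (R k ω : ℝ≥0∞) < M.exitTime (M.pt i) := by
          rw [hi]
          exact (ENNReal.coe_lt_coe.2 h2).trans_le (hS k)
        have hmem := subset_closure (PDMP.flow_mem_of_lt_exitTime (M.pt_mem i) hlt)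
        rw [if_pos ⟨h1, h2⟩, stateBeforeJump, indicator_of_mem h1, indicator_of_mem h2,
          indicator_of_mem hmem, mul_one, ← hi]
      · rw [if_neg fun h => h2 h.2, indicator_of_notMem h2, mul_zero]
    · rw [if_neg fun h => h1 h.1, stateBeforeJump, indicator_of_notMem h1, zero_mul]
  · obtain ⟨i, hi⟩ := hZ n
    rw [hsum n _ i hi, ← hi]
    simp only [indicator, mem_ofPred_eq]

include hπ hg hC in
theorem integral_apply_stoppedState (hσ : IsStoppingTime P.filtration σ)
    (hR : P.IsAssociated σ R) (n : ℕ) :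
    Integrable (fun ω => g (P.stoppedState σ n ω)) μ ∧
      ∫ ω, g (P.stoppedState σ n ω) ∂μ
        = ∑ k ∈ Finset.range n, ∑ i, ∫ ω, P.runningTerm g σ R k i ω ∂μ
          + ∑ i, ∫ ω, P.terminalTerm g σ n i ω ∂μ := by
  have hae := P.apply_stoppedState_ae_eq hπ g hR n
  have hrun : ∀ k i, Integrable ({ω | P.Z k ω = M.pt i}.indicator fun ω =>
      P.stateBeforeJump g σ R k i ω *
        {ω | R k ω < P.S (k + 1) ω}.indicator (fun _ => (1 : ℝ)) ω) μ := by
    intro k i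
    refine Integrable.indicator ?_ (P.measurableSet_Z_eq k _)
    have hlt : MeasurableSet {ω | R k ω < P.S (k + 1) ω} :=
      measurableSet_lt ((hR k).1.mono (P.filtrationT_le hπ k) le_rfl) (P.measurable_S (k + 1))
    have hu := (P.integrable_stateBeforeJump hπ hg hC hσ (hR k).1 i).indicator hlt
    refine hu.congr (Filter.Eventually.of_forall fun ω => ?_)
    by_cases h : R k ω < P.S (k + 1) ω <;> simp [h]
  have hterm : ∀ i, Integrable ({ω | P.Z n ω = M.pt i}.indicator fun ω =>
      {ω | ((P.T n ω : ℝ≥0) : WithTop ℝ≥0) ≤ σ ω}.indicator (fun _ => g (M.pt i)) ω) μ := fun i =>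
    ((integrable_const _).indicator (P.filtrationT_le hπ n _
      (P.measurableSet_T_le_stoppingTime hπ hσ n))).indicator (P.measurableSet_Z_eq n _)
  have hsum1 := integrable_finsetSum (Finset.range n) fun k _ =>
    integrable_finsetSum Finset.univ fun i _ => hrun k i
  have hsum2 := integrable_finsetSum Finset.univ fun i _ => hterm i
  refine ⟨(hsum1.add hsum2).congr hae.symm, ?_⟩
  rw [integral_congr_ae hae, integral_add hsum1 hsum2, integral_finsetSum _ fun k _ =>
    integrable_finsetSum Finset.univ fun i _ => hrun k i, integral_finsetSum _ fun i _ => hterm i]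
  congr 1
  · refine Finset.sum_congr rfl fun k _ => ?_
    rw [integral_finsetSum _ fun i _ => hrun k i]
    refine Finset.sum_congr rfl fun i _ => ?_
    rw [integral_indicator (P.measurableSet_Z_eq k _),
      (P.integral_runningTerm hπ hg hC hσ (hR k).1 i).2]
  · refine Finset.sum_congr rfl fun i _ => ?_
    rw [integral_indicator (P.measurableSet_Z_eq n _), (P.integral_terminalTerm hπ g hσ n i).2]

end ObservedPDMP.Realization

end

theorem proposition4p2 {d q : ℕ} (M : ObservedPDMP d q)
    (g : EuclideanSpace ℝ (Fin d) → ℝ) (hg : Measurable ((closure M.E).domRestrict g))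
    (hgb : ∃ C, ∀ x ∈ closure M.E, |g x| ≤ C)
    (π : Fin q → ℝ) (hπ : π ∈ stdSimplex ℝ (Fin q))
    {Ω : Type*} {mΩ : MeasurableSpace Ω} (μ : Measure Ω) [IsProbabilityMeasure μ]
    (P : M.Realization π μ)
    (σ : Ω → WithTop ℝ≥0) (hσ : σ ∈ P.stoppingTimes) (n : ℕ) (hn : 1 ≤ n) :
    μ (P.filterZeroEq π) = 1 ∧
    (∃ R : ℕ → Ω → ℝ≥0, P.IsAssociated σ R) ∧
    ∀ R : ℕ → Ω → ℝ≥0, P.IsAssociated σ R →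
      Integrable (fun ω => g (P.stoppedState σ n ω)) (μ[|P.filterZeroEq π]) ∧
      (∀ k < n, ∀ i, Integrable (P.runningTerm g σ R k i) (μ[|P.filterZeroEq π])) ∧
      (∀ i, Integrable (P.terminalTerm g σ n i) (μ[|P.filterZeroEq π])) ∧
      ∫ ω, g (P.stoppedState σ n ω) ∂(μ[|P.filterZeroEq π])
        = ∑ k ∈ Finset.range n, ∑ i, ∫ ω, P.runningTerm g σ R k i ω ∂(μ[|P.filterZeroEq π])
          + ∑ i, ∫ ω, P.terminalTerm g σ n i ω ∂(μ[|P.filterZeroEq π]) := by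
  obtain ⟨C, hC⟩ := hgb
  have hmem := P.ae_mem_filterZeroEq hπ
  rw [cond_eq_self_of_ae hmem]
  refine ⟨?_, P.exists_isAssociated hπ hσ.1, fun R hR => ?_⟩
  · rw [measure_congr (Filter.eventuallyEq_univ.2 (show P.filterZeroEq π ∈ ae μ from hmem)),
      measure_univ]
  · have h := P.integral_apply_stoppedState hπ hg hC hσ.1 hR n
    exact ⟨h.1, fun k _ i => (P.integral_runningTerm hπ hg hC hσ.1 (hR k).1 i).1,
      fun i => (P.integral_terminalTerm hπ g hσ.1 n i).1, h.2⟩
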